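/- Let $K\ge 1$, $T>0$ and $B\in\mathbb R$. Let $\mathcal N$ be the network obtained from $K$ copies $\overline{I_1},\dots,\overline{I_K}$ of $(-\infty,0]$ by gluing them at $0$, with its path metric, and let $H_i:[0,T]\times(-\infty,0]\times\mathbb R\to\mathbb R$ $(1\le i\le K)$ be Lipschitz continuous on $[0,T]\times(-\infty,0]\times[-R,R]$ for every $R>0$ and coercive: $H_i(t,x,p)\to\infty$ as $|p|\to\infty$, uniformly in $(t,x)$. Consider the time-dependent Kirchhoff problem $$u_t+H_i(t,x,u_{x_i})=0\ \text{ in } I_i\times(0,T],\qquad \sum_{i=1}^K u_{x_i}=B\ \text{ on }\{0\}\times(0,T].$$ Test functions are the continuous $\varphi:\mathcal N\times[0,T]\to\mathbb R$ whose restriction to each $\overline{I_i}\times[0,T]$ is $C^1$ up to the boundary. An upper semi-continuous $u:\mathcal N\times[0,T]\to\mathbb R$ is a sub-solution if, for every test function $\varphi$ and every local maximum $(x,t)$ of $u-\varphi$ in $\mathcal N\times[0,T]$ with $t>0$, $$\varphi_t(x,t)+H_i(t,x,\varphi_{x_i}(x,t))\le 0\quad\text{if } x\in I_i=(-\infty,0),$$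 $$\min\Big\{\sum_{i=1}^K\varphi_{x_i}(0,t)-B,\ \varphi_t(0,t)+\min_i H_i(t,0,\varphi_{x_i}(0,t))\Big\}\le 0\quad\text{if } x=0.$$ A lower semi-continuous $v:\mathcal N\times[0,T]\to\mathbb R$ is a super-solution if the same holds with local minima of $v-\varphi$, with $\ge$ in place of $\le$, and with both minima replaced by maxima. Let $u$ be a bounded sub-solution and $v$ a bounded super-solution. Assume that at least one of $u(\cdot,0)$, $v(\cdot,0)$ is uniformly continuous on $\mathcal N$, and that the $H_i$ do not depend on $t$ or at least one of $u$, $v$ is Lipschitz continuous on $\mathcal N\times[0,T]$. Then, for every $t\in[0,T]$, $$\sup_{x\in\mathcal N}\big(u(x,t)-v(x,t)\big)\le\sup_{x\in\mathcal N}\big(u(x,0)-v(x,0)\big).$$ -/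

import Mathlib

/-!
The network is `K` copies of the half-line `(-∞, 0]` glued at `0`.  A point is a pair `(i, x)` with
`x ≤ 0`, where all the pairs `(i, 0)` are the same point, the junction.  A real function on
(network) × `[0, T]` is a family `w i x t` whose members agree at `x = 0`; only its values at
`x ≤ 0`, `t ∈ [0, T]` are ever used.
-/

/-- The closed edge `(-∞, 0]` times `[0, T]`. -/
def edgeCyl (T : ℝ) : Set (ℝ × ℝ) := Set.Iic 0 ×ˢ Set.Icc 0 T

/-- The members of the family agree at the junction: it is a function on (network) × `[0, T]`. -/
def Glued {K : ℕ} (T : ℝ) (w : Fin K → ℝ → ℝ → ℝ) : Prop :=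
  ∀ i j : Fin K, ∀ t ∈ Set.Icc 0 T, w i 0 t = w j 0 t

/-- A test function on (network) × `[0, T]`: continuous on the network, and on each closed edge
continuously differentiable in `(x, t)` up to the boundary (one-sided derivatives at `x = 0`,
`t = 0`, `t = T`).  The slopes `dx i 0 t` at the junction may differ from edge to edge. -/
structure NetworkTestFunction (K : ℕ) (T : ℝ) where
  /-- the function itself -/
  val : Fin K → ℝ → ℝ → ℝ
  /-- its space derivative on each edge -/
  dx : Fin K → ℝ → ℝ → ℝ
  /-- its time derivative -/
  dt : Fin K → ℝ → ℝ → ℝ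
  glued : Glued T val
  continuousOn_val : ∀ i, ContinuousOn (fun z : ℝ × ℝ => val i z.1 z.2) (edgeCyl T)
  continuousOn_dx : ∀ i, ContinuousOn (fun z : ℝ × ℝ => dx i z.1 z.2) (edgeCyl T)
  continuousOn_dt : ∀ i, ContinuousOn (fun z : ℝ × ℝ => dt i z.1 z.2) (edgeCyl T)
  hasDeriv_dx : ∀ i, ∀ x ≤ (0 : ℝ), ∀ t ∈ Set.Icc 0 T,
    HasDerivWithinAt (fun y => val i y t) (dx i x t) (Set.Iic 0) x
  hasDeriv_dt : ∀ i, ∀ x ≤ (0 : ℝ), ∀ t ∈ Set.Icc 0 T,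
    HasDerivWithinAt (fun s => val i x s) (dt i x t) (Set.Icc 0 T) t

/-- `u` is a viscosity sub-solution of `u_t + H_i(t, x, u_{x_i}) = 0` on the edges with the
Kirchhoff condition `∑ u_{x_i} = B` at the junction.  At the junction
`min {∑ φ_{x_i} - B, φ_t + min_i H_i(t, 0, φ_{x_i})} ≤ 0` is written out as a disjunction
(`φ.dt i 0 t` does not depend on `i`, because `φ` is glued). -/
structure IsSubsolution {K : ℕ} (T B : ℝ) (H : Fin K → ℝ → ℝ → ℝ → ℝ)
    (u : Fin K → ℝ → ℝ → ℝ) : Prop where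
  glued : Glued T u
  usc : ∀ i, UpperSemicontinuousOn (fun z : ℝ × ℝ => u i z.1 z.2) (edgeCyl T)
  edge : ∀ (φ : NetworkTestFunction K T) (i : Fin K), ∀ x < (0 : ℝ), ∀ t ∈ Set.Ioc 0 T,
    IsLocalMaxOn (fun z : ℝ × ℝ => u i z.1 z.2 - φ.val i z.1 z.2) (edgeCyl T) (x, t) →
      φ.dt i x t + H i t x (φ.dx i x t) ≤ 0
  junction : ∀ (φ : NetworkTestFunction K T), ∀ t ∈ Set.Ioc 0 T,
    (∀ i, IsLocalMaxOn (fun z : ℝ × ℝ => u i z.1 z.2 - φ.val i z.1 z.2) (edgeCyl T) (0, t)) →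
      (∑ i, φ.dx i 0 t ≤ B) ∨ ∃ i, φ.dt i 0 t + H i t 0 (φ.dx i 0 t) ≤ 0

/-- `v` is a viscosity super-solution of the same problem.  At the junction
`max {∑ φ_{x_i} - B, φ_t + max_i H_i(t, 0, φ_{x_i})} ≥ 0` is written out as a disjunction. -/
structure IsSupersolution {K : ℕ} (T B : ℝ) (H : Fin K → ℝ → ℝ → ℝ → ℝ)
    (v : Fin K → ℝ → ℝ → ℝ) : Prop where
  glued : Glued T v
  lsc : ∀ i, LowerSemicontinuousOn (fun z : ℝ × ℝ => v i z.1 z.2) (edgeCyl T)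
  edge : ∀ (φ : NetworkTestFunction K T) (i : Fin K), ∀ x < (0 : ℝ), ∀ t ∈ Set.Ioc 0 T,
    IsLocalMinOn (fun z : ℝ × ℝ => v i z.1 z.2 - φ.val i z.1 z.2) (edgeCyl T) (x, t) →
      0 ≤ φ.dt i x t + H i t x (φ.dx i x t)
  junction : ∀ (φ : NetworkTestFunction K T), ∀ t ∈ Set.Ioc 0 T,
    (∀ i, IsLocalMinOn (fun z : ℝ × ℝ => v i z.1 z.2 - φ.val i z.1 z.2) (edgeCyl T) (0, t)) →
      (B ≤ ∑ i, φ.dx i 0 t) ∨ ∃ i, 0 ≤ φ.dt i 0 t + H i t 0 (φ.dx i 0 t)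

/-- Each `H_i` is Lipschitz on `[0, T] × (-∞, 0] × [-R, R]`, for every `R`. -/
def HamiltonianLipschitz {K : ℕ} (T : ℝ) (H : Fin K → ℝ → ℝ → ℝ → ℝ) : Prop :=
  ∀ i, ∀ R > (0 : ℝ), ∃ L : ℝ, ∀ t ∈ Set.Icc 0 T, ∀ s ∈ Set.Icc 0 T, ∀ x ≤ (0 : ℝ), ∀ y ≤ (0 : ℝ),
    ∀ p q : ℝ, |p| ≤ R → |q| ≤ R →
      |H i t x p - H i s y q| ≤ L * (|t - s| + |x - y| + |p - q|)

/-- `H_i(t, x, p) → ∞` as `|p| → ∞`, uniformly in `(t, x)`. -/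
def HamiltonianCoercive {K : ℕ} (T : ℝ) (H : Fin K → ℝ → ℝ → ℝ → ℝ) : Prop :=
  ∀ i, ∀ M : ℝ, ∃ R : ℝ, ∀ t ∈ Set.Icc 0 T, ∀ x ≤ (0 : ℝ), ∀ p : ℝ, R ≤ |p| → M ≤ H i t x p

/-- The Hamiltonians do not depend on time. -/
def TimeIndependent {K : ℕ} (T : ℝ) (H : Fin K → ℝ → ℝ → ℝ → ℝ) : Prop :=
  ∀ i, ∀ t ∈ Set.Icc 0 T, ∀ s ∈ Set.Icc 0 T, ∀ x ≤ (0 : ℝ), ∀ p : ℝ, H i t x p = H i s x p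

/-- `w` is bounded on (network) × `[0, T]`. -/
def BoundedOnNetwork {K : ℕ} (T : ℝ) (w : Fin K → ℝ → ℝ → ℝ) : Prop :=
  ∃ M : ℝ, ∀ i, ∀ x ≤ (0 : ℝ), ∀ t ∈ Set.Icc 0 T, |w i x t| ≤ M

/-- `w` is Lipschitz on (network) × `[0, T]`.  For a glued family an estimate along each edge is
the same as one for the path metric of the network. -/
def LipschitzOnNetwork {K : ℕ} (T : ℝ) (w : Fin K → ℝ → ℝ → ℝ) : Prop :=
  ∃ L : ℝ, ∀ i, ∀ x ≤ (0 : ℝ), ∀ y ≤ (0 : ℝ), ∀ t ∈ Set.Icc 0 T, ∀ s ∈ Set.Icc 0 T,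
    |w i x t - w i y s| ≤ L * (|x - y| + |t - s|)

/-- `w(·, 0)` is uniformly continuous on the network; again it suffices to look at each edge. -/
def InitiallyUniformlyContinuous {K : ℕ} (w : Fin K → ℝ → ℝ → ℝ) : Prop :=
  ∀ i, UniformContinuousOn (fun x => w i x 0) (Set.Iic 0)

/-- `sup (u(·, t) - v(·, t))`, the supremum over the network. -/
noncomputable def supDiff {K : ℕ} (u v : Fin K → ℝ → ℝ → ℝ) (t : ℝ) : ℝ :=
  ⨆ z : Fin K × Set.Iic (0 : ℝ), (u z.1 z.2 t - v z.1 z.2 t)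

/-!
Writing `w = -v`, the claim concerns two sub-solutions: `u` for `(H, B)` and `w` for
`(-H(t, x, -p), -B)`.  Only the time variable is doubled, so a maximum of
`u(x, t) + w(x, s) - (t - s)² / 2ε` is attained at a single point `x` of the network.

* If `x` is interior, doubling `x` along the edge, with the coercivity of `H` keeping the slopes in
  a compact set, yields one slope `p` at which both viscosity inequalities hold.
* If `x` is the junction, one compares, as Lions and Souganidis do, the critical slopes of `u` and
  `w` on the edges: if no edge carried such a common slope, each would have an interval of slopes
  at which both equations fail, and the two Kirchhoff conditions would force `∑ p i ≤ B` and
  `B ≤ ∑ p i` for all `p i` in these intervals.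

Either way the two inequalities differ only through `H(t, x, p) - H(s, x, p)`, which vanishes for
time-independent `H` and is `O(|t - s|) = O(ε)` when `u` or `w` is Lipschitz in time; the strictness
`u - η t` absorbs it.  Finally an explicit barrier shows that `u` and `w` stay close to their
initial data near `t = 0`, which keeps the maximum away from the initial time.
-/

open Set Filter Topology

theorem exists_pos_le_le_mul_le {a b : ℝ} (ha : 0 < a) (hb : 0 < b) (C : ℝ) :
    ∃ r > 0, r ≤ a ∧ r ≤ b ∧ C * r ≤ a := by
  refine ⟨min (min a b) (a / (|C| + 1)), by positivity, (min_le_left _ _).trans (min_le_left _ _),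
    (min_le_left _ _).trans (min_le_right _ _), ?_⟩
  set r := min (min a b) (a / (|C| + 1))
  have hr : 0 < r := by positivity
  have : (|C| + 1) * r ≤ a := (le_div_iff₀' (by positivity)).1 (min_le_right _ _)
  nlinarith [le_abs_self C]

section SemicontinuousTools

theorem upperSemicontinuousOn_sub_continuousOn {X : Type*} [TopologicalSpace X] {S : Set X}
    {f g : X → ℝ} (hf : UpperSemicontinuousOn f S) (hg : ContinuousOn g S) :
    UpperSemicontinuousOn (fun x => f x - g x) S := by
  simpa only [sub_eq_add_neg, Pi.neg_apply] using hf.add hg.neg.upperSemicontinuousOn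

theorem exists_forall_le_of_lt_outside_compact {ι X : Type*} [Finite ι] [TopologicalSpace X]
    {S C : Set X} (hC : IsCompact C) (hCS : C ⊆ S) {f : ι → X → ℝ}
    (hf : ∀ i, UpperSemicontinuousOn (f i) S) {i₀ : ι} {x₀ : X} (hx₀ : x₀ ∈ S)
    (hout : ∀ i, ∀ x ∈ S, x ∉ C → f i x < f i₀ x₀) :
    ∃ i, ∃ x ∈ C, ∀ j, ∀ y ∈ S, f j y ≤ f i x := by
  have hx₀C : x₀ ∈ C := by
    by_contra h
    exact lt_irrefl _ (hout i₀ x₀ hx₀ h)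
  have hmax : ∀ i, ∃ x ∈ C, IsMaxOn (f i) C x := fun i =>
    ((hf i).mono hCS).exists_isMaxOn ⟨x₀, hx₀C⟩ hC
  choose x hxC hx using hmax
  have : Nonempty ι := ⟨i₀⟩
  obtain ⟨i, hi⟩ := Finite.exists_max fun i => f i (x i)
  refine ⟨i, x i, hxC i, fun j y hy => ?_⟩
  by_cases hyC : y ∈ C
  · exact (hx j hyC).trans (hi j)
  · exact (hout j y hy hyC).le.trans ((hx i₀ hx₀C).trans (hi i₀))

/-- The penalization principle behind every doubling of variables: a large multiple of `ψ` forces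
the maxima of `Φ - n ψ` towards the zeros of `ψ`. -/
theorem eventually_forall_sub_mul_lt {X : Type*} [TopologicalSpace X] {C : Set X}
    (hC : IsCompact C) {Φ ψ : X → ℝ} (hΦ : UpperSemicontinuousOn Φ C) (hψ : ContinuousOn ψ C)
    (hψ0 : ∀ z ∈ C, 0 ≤ ψ z) {m : ℝ} (hm : ∀ z ∈ C, ψ z = 0 → Φ z < m) :
    ∀ᶠ n : ℕ in atTop, ∀ z ∈ C, Φ z - n * ψ z < m := by
  refine hC.induction_on
    (p := fun S => ∀ᶠ n : ℕ in atTop, ∀ z ∈ S, z ∈ C → Φ z - n * ψ z < m)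
    (by simp) (fun s t hst ht => ht.mono fun n hn z hz => hn z (hst hz))
    (fun s t hs ht => by
      filter_upwards [hs, ht] with n hsn htn z hz
      exact hz.elim (hsn z) (htn z)) (fun z hz => ?_) |>.mono fun n hn z hz => hn z hz hz
  suffices h : ∃ k : ℕ, Φ z - k * ψ z < m by
    obtain ⟨k, hk⟩ := h
    have hnear := (upperSemicontinuousOn_sub_continuousOn hΦ (hψ.const_mul (k : ℝ))) z hz m hk
    refine ⟨_, hnear, ?_⟩
    filter_upwards [eventually_ge_atTop k] with n hn y hy hyC
    have : (k : ℝ) * ψ y ≤ n * ψ y :=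
      mul_le_mul_of_nonneg_right (by exact_mod_cast hn) (hψ0 y hyC)
    linarith [show Φ y - k * ψ y < m from hy]
  rcases (hψ0 z hz).eq_or_lt with h0 | hpos
  · exact ⟨0, by simpa using hm z hz h0.symm⟩
  · obtain ⟨k, hk⟩ := exists_nat_gt ((Φ z - m) / ψ z)
    exact ⟨k, by linarith [(div_lt_iff₀ hpos).1 hk]⟩

theorem eventually_fst_mem_nhdsWithin {X Y : Type*} [TopologicalSpace X] [TopologicalSpace Y]
    {s : Set X} {x : X} (hs : s ∈ 𝓝 x) (S : Set (X × Y)) (y : Y) :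
    ∀ᶠ z in 𝓝[S] (x, y), z.1 ∈ s :=
  mem_nhdsWithin_of_mem_nhds (continuousAt_fst.preimage_mem_nhds hs)

end SemicontinuousTools

section SoftAbs

/-- The smooth approximation `√(h² + x²) - h` of `|x|`. It is used both as a penalization of
infinity and as a bump of small slope. -/
noncomputable def softAbs (h x : ℝ) : ℝ := √(h ^ 2 + x ^ 2) - h

variable {h : ℝ}

theorem contDiff_softAbs (hh : h ≠ 0) : ContDiff ℝ 1 (softAbs h) :=
  ((contDiff_const.add (contDiff_id.pow 2)).sqrt fun x =>
    (by simp only [id_eq]; positivity : h ^ 2 + id x ^ 2 ≠ 0)).sub contDiff_const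

theorem hasDerivAt_softAbs (hh : h ≠ 0) (x : ℝ) :
    HasDerivAt (softAbs h) (x / √(h ^ 2 + x ^ 2)) x := by
  have hpos : 0 < h ^ 2 + x ^ 2 := by positivity
  refine (((hasDerivAt_pow 2 x).const_add (h ^ 2)).sqrt hpos.ne').sub_const h |>.congr_deriv ?_
  field_simp
  simp

theorem deriv_softAbs_zero (hh : h ≠ 0) : deriv (softAbs h) 0 = 0 := by
  simpa using (hasDerivAt_softAbs hh 0).deriv

theorem abs_deriv_softAbs_le_one (hh : h ≠ 0) (x : ℝ) : |deriv (softAbs h) x| ≤ 1 := by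
  have hpos : 0 < h ^ 2 + x ^ 2 := by positivity
  rw [(hasDerivAt_softAbs hh x).deriv, abs_div, abs_of_pos (Real.sqrt_pos.2 hpos),
    div_le_one (Real.sqrt_pos.2 hpos)]
  exact Real.abs_le_sqrt (by linarith [sq_nonneg h])

theorem deriv_const_mul_softAbs (hh : h ≠ 0) (β x : ℝ) :
    deriv (fun x => β * softAbs h x) x = β * deriv (softAbs h) x :=
  deriv_const_mul _ ((contDiff_softAbs hh).differentiable one_ne_zero x)

theorem abs_deriv_const_mul_softAbs_le (hh : h ≠ 0) {β : ℝ} (hβ : 0 ≤ β) (x : ℝ) :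
    |deriv (fun x => β * softAbs h x) x| ≤ β := by
  rw [deriv_const_mul_softAbs hh, abs_mul, abs_of_nonneg hβ]
  exact mul_le_of_le_one_right hβ (abs_deriv_softAbs_le_one hh x)

@[simp]
theorem softAbs_zero (hh : 0 ≤ h) : softAbs h 0 = 0 := by
  simp [softAbs, Real.sqrt_sq hh]

theorem softAbs_nonneg (h x : ℝ) : 0 ≤ softAbs h x :=
  sub_nonneg.2 ((le_abs_self h).trans (Real.abs_le_sqrt (by linarith [sq_nonneg x])))

theorem abs_sub_le_softAbs (h x : ℝ) : |x| - h ≤ softAbs h x :=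
  sub_le_sub_right (Real.abs_le_sqrt (by linarith [sq_nonneg h])) h

/-- The line of slope `p` through `(x₁, c)`, bent upwards on both sides of `x₁` so gently that its
slopes stay within `κ` of `p`. -/
noncomputable def bentLine (c p κ h x₁ x : ℝ) : ℝ := c + p * (x - x₁) + κ * softAbs h (x - x₁)

theorem contDiff_bentLine (hh : h ≠ 0) (c p κ x₁ : ℝ) : ContDiff ℝ 1 (bentLine c p κ h x₁) := by
  have := (contDiff_softAbs hh).comp (contDiff_id.sub (contDiff_const (c := x₁)))
  exact ((contDiff_const.add (contDiff_const.mul (contDiff_id.sub contDiff_const)))).add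
    (contDiff_const.mul this)

theorem abs_deriv_bentLine_sub_le (hh : h ≠ 0) (c p x₁ x : ℝ) {κ : ℝ} (hκ : 0 ≤ κ) :
    |deriv (bentLine c p κ h x₁) x - p| ≤ κ := by
  have hline : HasDerivAt (fun x => c + p * (x - x₁)) p x := by
    simpa using (((hasDerivAt_id x).sub_const x₁).const_mul p).const_add c
  have hbump :=
    ((contDiff_softAbs hh).differentiable one_ne_zero (x - x₁)).hasDerivAt.comp_sub_const x x₁
  have : HasDerivAt (bentLine c p κ h x₁) (p + κ * deriv (softAbs h) (x - x₁)) x :=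
    hline.add (hbump.const_mul κ)
  rw [this.deriv, add_sub_cancel_left, abs_mul, abs_of_nonneg hκ]
  exact mul_le_of_le_one_right hκ (abs_deriv_softAbs_le_one hh _)

theorem bentLine_self (hh : 0 ≤ h) (c p κ x₁ : ℝ) : bentLine c p κ h x₁ x₁ = c := by
  simp [bentLine, hh]

end SoftAbs

section SeparableSubsolutions

/-- The test function `θ i x + ψ t` with separated variables; the whole argument needs no others. -/
noncomputable def NetworkTestFunction.separable {K : ℕ} (T : ℝ) (θ : Fin K → ℝ → ℝ) (ψ : ℝ → ℝ)
    (hθ : ∀ i, ContDiff ℝ 1 (θ i)) (hψ : ContDiff ℝ 1 ψ) (h0 : ∀ i j, θ i 0 = θ j 0) :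
    NetworkTestFunction K T where
  val i x t := θ i x + ψ t
  dx i x _ := deriv (θ i) x
  dt _ _ t := deriv ψ t
  glued i j t _ := by simp only [h0 i j]
  continuousOn_val i := by
    have := (hθ i).continuous
    have := hψ.continuous
    fun_prop
  continuousOn_dx i :=
    (((hθ i).continuous_deriv le_rfl).comp continuous_fst).continuousOn
  continuousOn_dt _ := ((hψ.continuous_deriv le_rfl).comp continuous_snd).continuousOn
  hasDeriv_dx i x _ t _ :=
    ((((hθ i).differentiable one_ne_zero) x).hasDerivAt.add_const (ψ t)).hasDerivWithinAt
  hasDeriv_dt i x _ t _ :=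
    (((hψ.differentiable one_ne_zero) t).hasDerivAt.const_add (θ i x)).hasDerivWithinAt

/-- Sub-solutions of `u_t + F_i(t, x, u_{x_i}) = 0`, `∑ u_{x_i} = B`, tested only with functions
`θ i x + ψ t`. -/
structure IsSeparableSubsolution {K : ℕ} (T B : ℝ) (F : Fin K → ℝ → ℝ → ℝ → ℝ)
    (u : Fin K → ℝ → ℝ → ℝ) : Prop where
  glued : Glued T u
  usc : ∀ i, UpperSemicontinuousOn (fun z : ℝ × ℝ => u i z.1 z.2) (edgeCyl T)
  edge : ∀ θ ψ : ℝ → ℝ, ContDiff ℝ 1 θ → ContDiff ℝ 1 ψ → ∀ i, ∀ x < (0 : ℝ), ∀ t ∈ Ioc 0 T,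
    IsLocalMaxOn (fun z : ℝ × ℝ => u i z.1 z.2 - (θ z.1 + ψ z.2)) (edgeCyl T) (x, t) →
      deriv ψ t + F i t x (deriv θ x) ≤ 0
  junction : ∀ (θ : Fin K → ℝ → ℝ) (ψ : ℝ → ℝ), (∀ i, ContDiff ℝ 1 (θ i)) → ContDiff ℝ 1 ψ →
    (∀ i j, θ i 0 = θ j 0) → ∀ t ∈ Ioc 0 T,
    (∀ i, IsLocalMaxOn (fun z : ℝ × ℝ => u i z.1 z.2 - (θ i z.1 + ψ z.2)) (edgeCyl T) (0, t)) →
      (∑ i, deriv (θ i) 0 ≤ B) ∨ ∃ i, deriv ψ t + F i t 0 (deriv (θ i) 0) ≤ 0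

/-- The Hamiltonian of which `-v` is a sub-solution when `v` is a super-solution for `H`. -/
def reflectedHamiltonian {K : ℕ} (H : Fin K → ℝ → ℝ → ℝ → ℝ) : Fin K → ℝ → ℝ → ℝ → ℝ :=
  fun i t x p => -H i t x (-p)

/-- The Hamiltonian of which `u - (h x + η t)` is a sub-solution when `u` is one for `H`. -/
noncomputable def shiftedHamiltonian {K : ℕ} (h : ℝ → ℝ) (η : ℝ) (H : Fin K → ℝ → ℝ → ℝ → ℝ) :
    Fin K → ℝ → ℝ → ℝ → ℝ :=
  fun i t x p => H i t x (p + deriv h x) + η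

variable {K : ℕ} {T B : ℝ} {H : Fin K → ℝ → ℝ → ℝ → ℝ} {u v : Fin K → ℝ → ℝ → ℝ}

theorem IsSubsolution.isSeparableSubsolution (hu : IsSubsolution T B H u) :
    IsSeparableSubsolution T B H u where
  glued := hu.glued
  usc := hu.usc
  edge θ ψ hθ hψ i x hx t ht hm :=
    hu.edge (.separable T (fun _ => θ) ψ (fun _ => hθ) hψ fun _ _ => rfl) i x hx t ht hm
  junction θ ψ hθ hψ h0 t ht hm := hu.junction (.separable T θ ψ hθ hψ h0) t ht hm

theorem IsSupersolution.isSeparableSubsolution_neg (hv : IsSupersolution T B H v) :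
    IsSeparableSubsolution T (-B) (reflectedHamiltonian H) (fun i x t => -v i x t) where
  glued i j t ht := by simp only [hv.glued i j t ht]
  usc i x hx y hy := by
    filter_upwards [hv.lsc i x hx (-y) (by dsimp only at hy ⊢; linarith)] with z hz
    linarith
  edge θ ψ hθ hψ i x hx t ht hm := by
    have := hv.edge (.separable T (fun _ x => -θ x) (fun t => -ψ t) (fun _ => hθ.neg) hψ.neg
      fun _ _ => rfl) i x hx t ht (by
        filter_upwards [hm] with z hz
        simp only [NetworkTestFunction.separable] at hz ⊢
        linarith)
    simp only [NetworkTestFunction.separable, deriv.fun_neg'] at this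
    simp only [reflectedHamiltonian]
    linarith
  junction θ ψ hθ hψ h0 t ht hm := by
    have := hv.junction (.separable T (fun i x => -θ i x) (fun t => -ψ t) (fun i => (hθ i).neg)
      hψ.neg fun i j => by simp only [h0 i j]) t ht (fun i => by
        filter_upwards [hm i] with z hz
        simp only [NetworkTestFunction.separable] at hz ⊢
        linarith)
    simp only [NetworkTestFunction.separable, deriv.fun_neg', Finset.sum_neg_distrib] at this
    simp only [reflectedHamiltonian]
    exact this.imp (fun h => by linarith) fun ⟨i, h⟩ => ⟨i, by linarith⟩

theorem IsSeparableSubsolution.sub_separable (hu : IsSeparableSubsolution T B H u) {h : ℝ → ℝ}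
    (hh : ContDiff ℝ 1 h) (hh0 : deriv h 0 = 0) (η : ℝ) :
    IsSeparableSubsolution T B (shiftedHamiltonian h η H)
      (fun i x t => u i x t - (h x + η * t)) := by
  have hη : ContDiff ℝ 1 fun t : ℝ => η * t := by fun_prop
  have hdx : ∀ {θ : ℝ → ℝ}, ContDiff ℝ 1 θ → ∀ x,
      deriv (fun y => θ y + h y) x = deriv θ x + deriv h x := fun hθ x =>
    deriv_fun_add (hθ.differentiable one_ne_zero x) (hh.differentiable one_ne_zero x)
  have hdt : ∀ {ψ : ℝ → ℝ}, ContDiff ℝ 1 ψ → ∀ t,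
      deriv (fun s => ψ s + η * s) t = deriv ψ t + η := fun hψ t => by
    rw [deriv_fun_add (hψ.differentiable one_ne_zero t) (hη.differentiable one_ne_zero t)]
    simp
  refine ⟨fun i j t ht => by simp only [hu.glued i j t ht], fun i => ?_, ?_, ?_⟩
  · have := hh.continuous
    exact upperSemicontinuousOn_sub_continuousOn (hu.usc i) (by fun_prop)
  · intro θ ψ hθ hψ i x hx t ht hm
    have := hu.edge (fun x => θ x + h x) (fun t => ψ t + η * t) (hθ.add hh) (hψ.add hη) i x hx t ht
      (by filter_upwards [hm] with z hz; linarith)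
    rw [hdx hθ, hdt hψ] at this
    simp only [shiftedHamiltonian]
    linarith
  · intro θ ψ hθ hψ h0 t ht hm
    have := hu.junction (fun i x => θ i x + h x) (fun t => ψ t + η * t) (fun i => (hθ i).add hh)
      (hψ.add hη) (fun i j => by simp only [h0 i j]) t ht
      (fun i => by filter_upwards [hm i] with z hz; linarith)
    simp only [hdx (hθ _), hdt hψ, hh0, add_zero] at this
    simp only [shiftedHamiltonian, hh0, add_zero]
    exact this.imp id fun ⟨i, hi⟩ => ⟨i, by linarith⟩

end SeparableSubsolutions

section EdgeSubsolutions

/-- Sub-solutions of `f(t, x, U_x) = 0` on an edge, tested with functions of `x` only. -/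
structure IsEdgeSubsolution (T : ℝ) (f : ℝ → ℝ → ℝ → ℝ) (U : ℝ → ℝ → ℝ) : Prop where
  usc : UpperSemicontinuousOn (fun z : ℝ × ℝ => U z.1 z.2) (edgeCyl T)
  edge : ∀ θ : ℝ → ℝ, ContDiff ℝ 1 θ → ∀ x < (0 : ℝ), ∀ t ∈ Ioc 0 T,
    IsLocalMaxOn (fun z : ℝ × ℝ => U z.1 z.2 - θ z.1) (edgeCyl T) (x, t) →
      f t x (deriv θ x) ≤ 0

/-- Joint continuity of a one-edge Hamiltonian `f t x p` on `[0, T] × (-∞, 0] × ℝ`. -/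
def ContinuousHamiltonian (T : ℝ) (f : ℝ → ℝ → ℝ → ℝ) : Prop :=
  ContinuousOn (fun z : ℝ × ℝ × ℝ => f z.1 z.2.1 z.2.2) (Icc 0 T ×ˢ Iic 0 ×ˢ univ)

/-- The slopes `p` for which `U 0 τ + p x` lies above all `U x t` near the junction. When `U 0 ·` is
largest at `τ`, their supremum is the critical slope of Lions and Souganidis. -/
def upperSlopes (T τ : ℝ) (U : ℝ → ℝ → ℝ) : Set ℝ :=
  {p | ∀ᶠ x in 𝓝[<] 0, ∀ t ∈ Icc 0 T, U x t ≤ U 0 τ + p * x}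

/-- The slopes `p` for which `U 0 τ + p x` lies below some `U x t`, for every `x` near the
junction. -/
def lowerSlopes (T τ : ℝ) (U : ℝ → ℝ → ℝ) : Set ℝ :=
  {p | ∀ᶠ x in 𝓝[<] 0, ∃ t ∈ Icc 0 T, U 0 τ + p * x ≤ U x t}

variable {T τ : ℝ} {f : ℝ → ℝ → ℝ → ℝ} {U : ℝ → ℝ → ℝ}

theorem isLowerSet_upperSlopes : IsLowerSet (upperSlopes T τ U) := fun p q hqp hp => by
  filter_upwards [hp, self_mem_nhdsWithin] with x hx hx0 t ht
  have := mul_le_mul_of_nonpos_right hqp (le_of_lt hx0)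
  linarith [hx t ht]

theorem le_of_mem_upperSlopes_of_mem_lowerSlopes {p q : ℝ} (hp : p ∈ upperSlopes T τ U)
    (hq : q ∈ lowerSlopes T τ U) : p ≤ q := by
  have hle : ∀ᶠ x in 𝓝[<] (0 : ℝ), q * x ≤ p * x := by
    filter_upwards [hp, hq] with x hpx ⟨t, ht, hqx⟩
    linarith [hpx t ht]
  obtain ⟨x, hx, hx0⟩ := (hle.and self_mem_nhdsWithin).exists
  exact (mul_le_mul_right_of_neg hx0).1 hx

theorem exists_lt_of_notMem_upperSlopes {p b : ℝ} (hp : p ∉ upperSlopes T τ U) (hb : b < 0) :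
    ∃ x ∈ Ioo b 0, ∃ t ∈ Icc 0 T, U 0 τ + p * x < U x t := by
  by_contra! h
  exact hp (mem_of_superset (Ioo_mem_nhdsLT hb) h)

theorem exists_lt_of_notMem_lowerSlopes {p b : ℝ} (hp : p ∉ lowerSlopes T τ U) (hb : b < 0) :
    ∃ x ∈ Ioo b 0, ∀ t ∈ Icc 0 T, U x t < U 0 τ + p * x := by
  by_contra! h
  exact hp (mem_of_superset (Ioo_mem_nhdsLT hb) h)

theorem IsEdgeSubsolution.exists_touch (hU : IsEdgeSubsolution T f U) {θ : ℝ → ℝ}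
    (hθ : ContDiff ℝ 1 θ) {a b x₁ t₁ : ℝ} (hb0 : b ≤ 0) (hx₁ : x₁ ∈ Icc a b) (ht₁ : t₁ ∈ Icc 0 T)
    (ha : ∀ t ∈ Icc 0 T, U a t < θ a) (hb : ∀ t ∈ Icc 0 T, U b t < θ b) (h₁ : θ x₁ ≤ U x₁ t₁) :
    ∃ x ∈ Ioo a b, ∃ t ∈ Icc 0 T, θ x ≤ U x t ∧ (0 < t → f t x (deriv θ x) ≤ 0) := by
  have hsub : Icc a b ×ˢ Icc 0 T ⊆ edgeCyl T :=
    prod_mono (fun y hy => hy.2.trans hb0) subset_rfl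
  have hcont : Continuous fun z : ℝ × ℝ => θ z.1 := hθ.continuous.comp continuous_fst
  obtain ⟨⟨x, t⟩, ⟨hx, ht⟩, hmax⟩ :=
    (upperSemicontinuousOn_sub_continuousOn (hU.usc.mono hsub) hcont.continuousOn).exists_isMaxOn
      ⟨(x₁, t₁), mk_mem_prod hx₁ ht₁⟩ (isCompact_Icc.prod isCompact_Icc)
  have htouch : θ x ≤ U x t := by
    have : U x₁ t₁ - θ x₁ ≤ U x t - θ x := isMaxOn_iff.1 hmax (x₁, t₁) ⟨hx₁, ht₁⟩
    linarith
  have hxa : a ≠ x := by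
    rintro rfl
    exact (ha t ht).not_ge htouch
  have hxb : x ≠ b := by
    rintro rfl
    exact (hb t ht).not_ge htouch
  have hx' : x ∈ Ioo a b := ⟨hx.1.lt_of_ne hxa, hx.2.lt_of_ne hxb⟩
  refine ⟨x, hx', t, ht, htouch,
    fun ht0 => hU.edge θ hθ x (hx'.2.trans_le hb0) t ⟨ht0, ht.2⟩ ?_⟩
  filter_upwards [eventually_fst_mem_nhdsWithin (Ioo_mem_nhds hx'.1 hx'.2) (edgeCyl T) t,
    self_mem_nhdsWithin] with z hz hz'
  exact hmax ⟨Ioo_subset_Icc_self hz, hz'.2⟩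

theorem exists_pos_forall_lt_sub
    (husc : UpperSemicontinuousOn (fun z : ℝ × ℝ => U z.1 z.2) (edgeCyl T))
    {C : Set ℝ} (hC : IsCompact C) (hCT : C ⊆ Icc 0 T) {m : ℝ} (hm : ∀ t ∈ C, U 0 t < m) :
    ∃ δ > 0, ∀ x ∈ Icc (-δ) 0, ∀ t ∈ C, U x t < m - δ := by
  have h : ∀ᶠ z : ℝ × ℝ in 𝓝 (0, 0), ∀ t ∈ C, (z.1, t) ∈ edgeCyl T → U z.1 t < m - z.2 := by
    refine hC.eventually_forall_of_forall_eventually fun t ht => ?_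
    obtain ⟨m', htm', hm'⟩ := exists_between (hm t ht)
    have hU : ∀ᶠ z : ℝ × ℝ in 𝓝 (0, t), z ∈ edgeCyl T → U z.1 z.2 < m' :=
      eventually_nhdsWithin_iff.1 (husc (0, t) ⟨le_refl (0 : ℝ), hCT ht⟩ m' htm')
    have hlim : Tendsto (fun w : (ℝ × ℝ) × ℝ => (w.1.1, w.2)) (𝓝 ((0, 0), t)) (𝓝 (0, t)) :=
      (by fun_prop : Continuous fun w : (ℝ × ℝ) × ℝ => (w.1.1, w.2)).tendsto' _ _ rfl
    have hlevel : ∀ᶠ w : (ℝ × ℝ) × ℝ in 𝓝 ((0, 0), t), w.1.2 < m - m' :=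
      (by fun_prop : Continuous fun w : (ℝ × ℝ) × ℝ => w.1.2).tendsto' ((0, 0), t) 0 rfl
        |>.eventually_lt_const (sub_pos.2 hm')
    filter_upwards [hlim.eventually hU, hlevel] with w hw hw' hmem
    linarith [hw hmem]
  obtain ⟨r, hr, h⟩ := Metric.eventually_nhds_iff.1 h
  refine ⟨r / 2, half_pos hr, fun x hx t ht => h (y := (x, r / 2)) ?_ t ht ⟨hx.2, hCT ht⟩⟩
  rw [Prod.dist_eq, Real.dist_eq, Real.dist_eq, sub_zero, sub_zero, abs_of_nonpos hx.2,
    abs_of_pos (half_pos hr)]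
  exact max_lt (by linarith [hx.1]) (half_lt_self hr)

theorem IsEdgeSubsolution.exists_touch_near_junction (hU : IsEdgeSubsolution T f U)
    (hmax : ∀ t ∈ Icc 0 T, t ≠ τ → U 0 t < U 0 τ) {ρ : ℝ} (hρ : 0 < ρ) (hρτ : ρ ≤ τ) :
    ∃ δ > 0, ∀ (θ : ℝ → ℝ) (a x₁ t₁ : ℝ), ContDiff ℝ 1 θ → -δ ≤ a → x₁ ∈ Icc a 0 → t₁ ∈ Icc 0 T →
      (∀ t ∈ Icc 0 T, U a t < θ a) → U 0 τ < θ 0 → θ x₁ ≤ U x₁ t₁ →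
      (∀ x ∈ Icc a 0, U 0 τ - δ ≤ θ x) →
      ∃ x ∈ Ioo a 0, ∃ t ∈ Icc 0 T, |t - τ| < ρ ∧ f t x (deriv θ x) ≤ 0 := by
  have hC : IsCompact (Icc 0 T ∩ {t | ρ ≤ |t - τ|}) :=
    isCompact_Icc.inter_right (isClosed_le continuous_const (by fun_prop))
  obtain ⟨δ, hδ, hfar⟩ := exists_pos_forall_lt_sub hU.usc hC inter_subset_left
    (m := U 0 τ) fun t ht => hmax t ht.1 (by
      rintro rfl
      simpa [hρ.not_ge] using ht.2)
  refine ⟨δ, hδ, fun θ a x₁ t₁ hθ ha hx₁ ht₁ hUa hθ0 h₁ hθδ => ?_⟩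
  obtain ⟨x, hx, t, ht, htouch, hf⟩ := hU.exists_touch hθ le_rfl hx₁ ht₁ hUa (fun t ht => by
    rcases eq_or_ne t τ with rfl | hne
    · exact hθ0
    · exact (hmax t ht hne).trans hθ0) h₁
  have htτ : |t - τ| < ρ := by
    by_contra! hge
    have := hfar x ⟨ha.trans hx.1.le, hx.2.le⟩ t ⟨ht, hge⟩
    linarith [hθδ x (Ioo_subset_Icc_self hx)]
  exact ⟨x, hx, t, ht, htτ, hf (by linarith [(abs_lt.1 htτ).1])⟩

theorem ContinuousHamiltonian.exists_forall_pos (hf : ContinuousHamiltonian T f) {x₀ p : ℝ}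
    (hτ : τ ∈ Ioc 0 T) (hx₀ : x₀ ≤ 0) (hp : 0 < f τ x₀ p) :
    ∃ ρ > 0, ρ ≤ τ ∧ ∀ t ∈ Icc 0 T, ∀ x ≤ (0 : ℝ), ∀ q, |t - τ| < ρ → |x - x₀| < ρ → |q - p| < ρ →
      0 < f t x q := by
  have hnear := (hf (τ, x₀, p) ⟨Ioc_subset_Icc_self hτ, hx₀, mem_univ _⟩).eventually
    (lt_mem_nhds hp)
  obtain ⟨ρ, hρ, hball⟩ := Metric.eventually_nhds_iff.1 (eventually_nhdsWithin_iff.1 hnear)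
  refine ⟨min ρ τ, lt_min hρ hτ.1, min_le_right _ _, fun t ht x hx q htρ hxρ hqρ => ?_⟩
  refine hball (y := (t, x, q)) ?_ ⟨ht, hx, mem_univ _⟩
  simp only [Prod.dist_eq, Real.dist_eq]
  exact max_lt (htρ.trans_le (min_le_left _ _)) (max_lt (hxρ.trans_le (min_le_left _ _))
    (hqρ.trans_le (min_le_left _ _)))

/-- The test function is the line of slope `p` through a high point of `U`, bent upwards by a bump
so small that its slope stays in the region where `f` is positive. -/
theorem IsEdgeSubsolution.nonpos_of_slope (hU : IsEdgeSubsolution T f U)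
    (hf : ContinuousHamiltonian T f) (hτ : τ ∈ Ioc 0 T)
    (hmax : ∀ t ∈ Icc 0 T, t ≠ τ → U 0 t < U 0 τ) {p : ℝ}
    (hp : ∀ ε > 0, p + ε ∉ upperSlopes T τ U) (hp' : ∀ ε > 0, p - ε ∉ lowerSlopes T τ U) :
    f τ 0 p ≤ 0 := by
  by_contra! hpos
  obtain ⟨ρ, hρ, hρτ, hfpos⟩ := hf.exists_forall_pos hτ le_rfl hpos
  obtain ⟨δ, hδ, htouch⟩ := hU.exists_touch_near_junction hmax hρ hρτ
  set κ := ρ / 2 with hκ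
  have hκ0 : 0 < κ := half_pos hρ
  obtain ⟨r, hr0, hrδ, hrρ, hrp⟩ := exists_pos_le_le_mul_le hδ hρ (|p| + κ)
  obtain ⟨y, hy, hyU⟩ := exists_lt_of_notMem_lowerSlopes (hp' (κ / 4) (by positivity))
    (neg_lt_zero.2 hr0)
  obtain ⟨x₁, hx₁, t₁, ht₁, hx₁U⟩ :=
    exists_lt_of_notMem_upperSlopes (hp (κ / 4) (by positivity)) (b := y / 2) (by linarith [hy.2])
  set h := -x₁ / 4 with hh
  have hh0 : 0 < h := by linarith [hx₁.2]
  set θ := bentLine (U x₁ t₁) p κ h x₁ with hθ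
  have hθ_gt : ∀ x, U 0 τ + p * x + κ * (softAbs h (x - x₁) - h) < θ x := fun x => by
    have : κ * h = -(κ / 4 * x₁) := by rw [hh]; ring
    simp only [hθ, bentLine]
    linarith
  obtain ⟨x, hx, t, ht, htτ, hfx⟩ :
      ∃ x ∈ Ioo y 0, ∃ t ∈ Icc 0 T, |t - τ| < ρ ∧ f t x (deriv θ x) ≤ 0 := by
    refine htouch θ y x₁ t₁ (contDiff_bentLine hh0.ne' ..) (by linarith [hy.1])
      ⟨by linarith [hx₁.1, hy.2], hx₁.2.le⟩ ht₁ (fun t ht => ?_) ?_ (bentLine_self hh0.le ..).le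
      fun x hx => ?_
    · have := abs_sub_le_softAbs h (y - x₁)
      rw [abs_of_nonpos (by linarith [hx₁.1, hy.2])] at this
      nlinarith [hθ_gt y, hyU t ht, hx₁.1]
    · have := abs_sub_le_softAbs h (0 - x₁)
      rw [abs_of_nonneg (by linarith [hx₁.2])] at this
      nlinarith [hθ_gt 0]
    · have hxr : |x| ≤ r := by
        rw [abs_of_nonpos hx.2]
        linarith [hx.1, hy.1]
      have hline := (neg_abs_le (p * x)).trans' (neg_le_neg
        ((abs_mul p x).trans_le (mul_le_mul_of_nonneg_left hxr (abs_nonneg p))))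
      nlinarith [hθ_gt x, softAbs_nonneg h (x - x₁), hx₁.1, hy.1]
  refine hfx.not_gt (hfpos t ht x hx.2.le _ htτ ?_ ?_)
  · rw [sub_zero, abs_of_neg hx.2]
    linarith [hx.1, hy.1]
  · exact (abs_deriv_bentLine_sub_le hh0.ne' _ _ _ _ hκ0.le).trans_lt (half_lt_self hρ)

/-- The test function is linear, so steep that coercivity makes `f` positive along it. -/
theorem IsEdgeSubsolution.upperSlopes_nonempty (hU : IsEdgeSubsolution T f U) (hτ : 0 < τ)
    (hmax : ∀ t ∈ Icc 0 T, t ≠ τ → U 0 t < U 0 τ) {R : ℝ}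
    (hf : ∀ t ∈ Icc 0 T, ∀ x ≤ (0 : ℝ), ∀ p, R ≤ |p| → 0 < f t x p) :
    (upperSlopes T τ U).Nonempty := by
  obtain ⟨δ, hδ, htouch⟩ := hU.exists_touch_near_junction hmax hτ le_rfl
  obtain ⟨δ', hδ', hnear⟩ := exists_pos_forall_lt_sub hU.usc isCompact_Icc subset_rfl
    (m := U 0 τ + δ) fun t ht => by
      rcases eq_or_ne t τ with rfl | hne
      · linarith
      · linarith [hmax t ht hne]
  obtain ⟨r, hr0, hrδ, hrδ', hrR⟩ := exists_pos_le_le_mul_le hδ hδ' R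
  set q := δ / r
  have hq0 : 0 < q := div_pos hδ hr0
  have hqr : q * r = δ := div_mul_cancel₀ _ hr0.ne'
  have hRq : R ≤ q := (le_div_iff₀ hr0).2 hrR
  refine ⟨-q, ?_⟩
  by_contra hcon
  obtain ⟨x₁, hx₁, t₁, ht₁, hx₁U⟩ := exists_lt_of_notMem_upperSlopes hcon (neg_lt_zero.2 hr0)
  obtain ⟨x, hx, t, ht, -, hfx⟩ := htouch (fun x => U x₁ t₁ + -q * (x - x₁)) (-r) x₁ t₁
    (by fun_prop) (by linarith) (Ioo_subset_Icc_self hx₁) ht₁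
    (fun t ht => by linarith [hnear (-r) ⟨by linarith, by linarith⟩ t ht]) (by linarith) (by simp)
    fun x hx => by nlinarith [hx.2]
  have hderiv : deriv (fun x => U x₁ t₁ + -q * (x - x₁)) x = -q := by simp
  rw [hderiv] at hfx
  exact hfx.not_gt (hf t ht x hx.2.le _ (by rwa [abs_neg, abs_of_pos hq0]))

theorem IsEdgeSubsolution.nonpos_of_isLUB_upperSlopes (hU : IsEdgeSubsolution T f U)
    (hf : ContinuousHamiltonian T f) (hτ : τ ∈ Ioc 0 T)
    (hmax : ∀ t ∈ Icc 0 T, t ≠ τ → U 0 t < U 0 τ) {a : ℝ} (ha : IsLUB (upperSlopes T τ U) a) :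
    f τ 0 a ≤ 0 := by
  refine hU.nonpos_of_slope hf hτ hmax (fun ε hε hmem => ?_) fun ε hε hmem => ?_
  · linarith [ha.1 hmem]
  · obtain ⟨q, hq, haq⟩ := (lt_isLUB_iff ha).1 (sub_lt_self a hε)
    exact haq.not_ge (le_of_mem_upperSlopes_of_mem_lowerSlopes hq hmem)

end EdgeSubsolutions

section Junction

/-- `(x₀, τ, σ)` maximizes `U x t + W x s`, and no other pair of times does so at `x₀`. -/
structure IsTimeStrictMax (T x₀ τ σ : ℝ) (U W : ℝ → ℝ → ℝ) : Prop where
  left_mem : τ ∈ Ioc 0 T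
  right_mem : σ ∈ Ioc 0 T
  le : ∀ x ≤ (0 : ℝ), ∀ t ∈ Icc 0 T, ∀ s ∈ Icc 0 T, U x t + W x s ≤ U x₀ τ + W x₀ σ
  eq_of_le : ∀ t ∈ Icc 0 T, ∀ s ∈ Icc 0 T, U x₀ τ + W x₀ σ ≤ U x₀ t + W x₀ s → t = τ ∧ s = σ

/-- The weak form of coercivity that the analysis at a fixed point uses: `f` is positive for all
large slopes. -/
def PositiveAtLargeSlopes (T : ℝ) (f : ℝ → ℝ → ℝ → ℝ) : Prop :=
  ∃ R : ℝ, ∀ t ∈ Icc 0 T, ∀ x ≤ (0 : ℝ), ∀ p, R ≤ |p| → 0 < f t x p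

/-- The Kirchhoff condition for sub-solutions in terms of slopes: `S i` is the set of slopes with
which the solution is touched from above on the edge `i`, and `F i` the equation there. -/
def JunctionCondition {ι : Type*} [Fintype ι] (B : ℝ) (F : ι → ℝ → ℝ) (S : ι → Set ℝ) : Prop :=
  ∀ p : ι → ℝ, (∀ i, p i ∈ S i) → ∑ i, p i ≤ B ∨ ∃ i, F i (p i) ≤ 0

theorem exists_Ioo_forall_pos_and_pos {φ γ : ℝ → ℝ} (hφ : Continuous φ) (hγ : Continuous γ)
    {a b : ℝ} (hab : a < b) (ha : 0 < φ a) (hb : φ b ≤ 0) (h : ∀ p, φ p ≤ 0 → 0 < γ p) :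
    ∃ l r, a ≤ l ∧ l < r ∧ r ≤ b ∧ ∀ p ∈ Ioo l r, 0 < φ p ∧ 0 < γ p := by
  have hZ : IsCompact (Icc a b ∩ {p | φ p ≤ 0}) :=
    isCompact_Icc.inter_right (isClosed_le hφ continuous_const)
  obtain ⟨r, ⟨⟨har, hrb⟩, hφr⟩, hr⟩ := hZ.exists_isLeast ⟨b, ⟨hab.le, le_rfl⟩, hb⟩
  have har' : a < r := har.lt_of_ne fun h => ha.not_ge (h ▸ hφr)
  obtain ⟨l, hlr, hl⟩ := exists_Ioc_subset_of_mem_nhds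
    (hγ.continuousAt.eventually (lt_mem_nhds (h r hφr))) ⟨a, har'⟩
  refine ⟨max a l, r, le_max_left _ _, max_lt har' hlr, hrb, fun p hp => ⟨?_, ?_⟩⟩
  · by_contra! hφp
    exact hp.2.not_ge (hr ⟨⟨(le_max_left _ _).trans hp.1.le, hp.2.le.trans hrb⟩, hφp⟩)
  · exact hl ⟨(le_max_right _ _).trans_lt hp.1, hp.2.le⟩

section Edge

variable {T x₀ τ σ : ℝ} {f g : ℝ → ℝ → ℝ → ℝ} {U W : ℝ → ℝ → ℝ}

theorem ContinuousHamiltonian.continuous_slope (hf : ContinuousHamiltonian T f)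
    (hτ : τ ∈ Icc 0 T) (hx₀ : x₀ ≤ 0) : Continuous (f τ x₀) :=
  hf.comp_continuous (f := fun p : ℝ => (τ, x₀, p)) (by fun_prop) fun _ => ⟨hτ, hx₀, mem_univ _⟩

theorem IsTimeStrictMax.symm (hm : IsTimeStrictMax T x₀ τ σ U W) :
    IsTimeStrictMax T x₀ σ τ W U where
  left_mem := hm.right_mem
  right_mem := hm.left_mem
  le x hx t ht s hs := by linarith [hm.le x hx s hs t ht]
  eq_of_le t ht s hs h := (hm.eq_of_le s hs t ht (by linarith)).symm

theorem IsTimeStrictMax.lt_of_ne (hm : IsTimeStrictMax T x₀ τ σ U W) :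
    ∀ t ∈ Icc 0 T, t ≠ τ → U x₀ t < U x₀ τ := fun t ht hne => by
  by_contra! hle
  exact hne (hm.eq_of_le t ht σ (Ioc_subset_Icc_self hm.right_mem) (by linarith)).1

theorem IsTimeStrictMax.neg_mem_upperSlopes (hm : IsTimeStrictMax T 0 τ σ U W) {p : ℝ}
    (hp : p ∈ lowerSlopes T τ U) : -p ∈ upperSlopes T σ W := by
  filter_upwards [hp, self_mem_nhdsWithin] with x ⟨t, ht, hUx⟩ hx s hs
  linarith [hm.le x (le_of_lt hx) t ht s hs]

theorem IsTimeStrictMax.nonpos_of_notMem_upperSlopes (hm : IsTimeStrictMax T 0 τ σ U W)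
    (hU : IsEdgeSubsolution T f U) (hf : ContinuousHamiltonian T f) {p : ℝ}
    (hp : p ∉ upperSlopes T τ U) (hp' : -p ∉ upperSlopes T σ W) : f τ 0 p ≤ 0 :=
  hU.nonpos_of_slope hf hm.left_mem hm.lt_of_ne
    (fun ε hε h => hp (isLowerSet_upperSlopes (by linarith) h))
    fun ε hε h => hp' (isLowerSet_upperSlopes (by linarith) (hm.neg_mem_upperSlopes h))

theorem IsTimeStrictMax.neg_mem_upperSlopes_of_notMem (hm : IsTimeStrictMax T 0 τ σ U W)
    (hU : IsEdgeSubsolution T f U) (hW : IsEdgeSubsolution T g W)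
    (hf : ContinuousHamiltonian T f) (hg : ContinuousHamiltonian T g) {p : ℝ}
    (hfg : f τ 0 p ≤ 0 → 0 < g σ 0 (-p)) (hp : p ∉ upperSlopes T τ U) :
    -p ∈ upperSlopes T σ W := by
  by_contra hp'
  exact (hfg (hm.nonpos_of_notMem_upperSlopes hU hf hp hp')).not_ge
    (hm.symm.nonpos_of_notMem_upperSlopes hW hg hp' (by rwa [neg_neg]))

theorem IsTimeStrictMax.exists_lt_pos_forall_neg_mem (hm : IsTimeStrictMax T 0 τ σ U W)
    (hU : IsEdgeSubsolution T f U) (hW : IsEdgeSubsolution T g W)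
    (hf : ContinuousHamiltonian T f) (hg : ContinuousHamiltonian T g)
    (hf' : PositiveAtLargeSlopes T f) {a : ℝ} (ha : IsLUB (upperSlopes T τ U) a)
    (hfg : ∀ p, f τ 0 p ≤ 0 → 0 < g σ 0 (-p)) :
    ∃ p₀ < a, 0 < f τ 0 p₀ ∧ ∀ p > p₀, -p ∈ upperSlopes T σ W := by
  have hW_of_gt : ∀ p > a, -p ∈ upperSlopes T σ W := fun p hp =>
    hm.neg_mem_upperSlopes_of_notMem hU hW hf hg (hfg p) fun h => (ha.1 h).not_gt hp
  by_cases hbW : BddAbove (upperSlopes T σ W)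
  · obtain ⟨b, hb⟩ := Real.exists_isLUB ⟨_, hW_of_gt (a + 1) (by linarith)⟩ hbW
    have hfb : 0 < f τ 0 (-b) := by
      by_contra! h
      have := hfg _ h
      rw [neg_neg] at this
      exact this.not_ge (hW.nonpos_of_isLUB_upperSlopes hg hm.right_mem hm.symm.lt_of_ne hb)
    have hba : -b ≤ a := le_of_forall_gt_imp_ge_of_dense fun p hp =>
      neg_le.1 (hb.1 (hW_of_gt p hp))
    have hba' : -b ≠ a := by
      rintro h
      exact (h ▸ hfb).not_ge (hU.nonpos_of_isLUB_upperSlopes hf hm.left_mem hm.lt_of_ne ha)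
    refine ⟨-b, hba.lt_of_ne hba', hfb, fun p hp => ?_⟩
    obtain ⟨q, hq, hpq⟩ := (lt_isLUB_iff hb).1 (neg_lt.1 hp)
    exact isLowerSet_upperSlopes hpq.le hq
  · obtain ⟨R, hR⟩ := hf'
    refine ⟨min (a - 1) (-|R|), (min_le_left _ _).trans_lt (by linarith), ?_, fun p _ => ?_⟩
    · refine hR τ (Ioc_subset_Icc_self hm.left_mem) 0 le_rfl _ ?_
      linarith [min_le_right (a - 1) (-|R|), neg_abs_le (min (a - 1) (-|R|)), le_abs_self R]
    · obtain ⟨q, hq, hpq⟩ := not_bddAbove_iff.1 hbW (-p)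
      exact isLowerSet_upperSlopes hpq.le hq

theorem IsTimeStrictMax.exists_slope_interval (hm : IsTimeStrictMax T 0 τ σ U W)
    (hU : IsEdgeSubsolution T f U) (hW : IsEdgeSubsolution T g W)
    (hf : ContinuousHamiltonian T f) (hg : ContinuousHamiltonian T g)
    (hf' : PositiveAtLargeSlopes T f) (hbdd : BddAbove (upperSlopes T τ U))
    (hfg : ∀ p, f τ 0 p ≤ 0 → 0 < g σ 0 (-p)) :
    ∃ l r, l < r ∧ ∀ p ∈ Ioo l r, p ∈ upperSlopes T τ U ∧ -p ∈ upperSlopes T σ W ∧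
      0 < f τ 0 p ∧ 0 < g σ 0 (-p) := by
  obtain ⟨R, hR⟩ := hf'
  obtain ⟨a, ha⟩ := Real.exists_isLUB
    (hU.upperSlopes_nonempty hm.left_mem.1 hm.lt_of_ne hR) hbdd
  obtain ⟨p₀, hp₀a, hfp₀, hp₀W⟩ :=
    hm.exists_lt_pos_forall_neg_mem hU hW hf hg ⟨R, hR⟩ ha hfg
  obtain ⟨l, r, hp₀l, hlr, hra, hpos⟩ := exists_Ioo_forall_pos_and_pos
    (hf.continuous_slope (Ioc_subset_Icc_self hm.left_mem) le_rfl)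
    ((hg.continuous_slope (Ioc_subset_Icc_self hm.right_mem) le_rfl).comp continuous_neg) hp₀a hfp₀
    (hU.nonpos_of_isLUB_upperSlopes hf hm.left_mem hm.lt_of_ne ha) hfg
  refine ⟨l, r, hlr, fun p hp => ⟨?_, hp₀W p (hp₀l.trans_lt hp.1), hpos p hp⟩⟩
  obtain ⟨q, hq, hpq⟩ := (lt_isLUB_iff ha).1 (hp.2.trans_le hra)
  exact isLowerSet_upperSlopes hpq.le hq

end Edge

theorem JunctionCondition.bddAbove {ι : Type*} [Fintype ι] {B : ℝ} {F : ι → ℝ → ℝ}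
    {S : ι → Set ℝ} (h : JunctionCondition B F S) (hS : ∀ i, IsLowerSet (S i))
    (hne : ∀ i, (S i).Nonempty) (hF : ∀ i, ∃ R : ℝ, ∀ p, R ≤ |p| → 0 < F i p) (i : ι) :
    BddAbove (S i) := by
  classical
  by_contra hunbdd
  choose R hR using hF
  choose q hq using hne
  let p₀ : ι → ℝ := fun j => min (q j) (-|R j|)
  let P : ℝ := max |R i| (B + 1 - ∑ j ∈ Finset.univ \ {i}, p₀ j)
  obtain ⟨P', hP', hPP'⟩ := not_bddAbove_iff.1 hunbdd P
  have hmem : ∀ j, Function.update p₀ i P j ∈ S j := fun j => by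
    rcases eq_or_ne j i with rfl | hji
    · rw [Function.update_self]
      exact hS j hPP'.le hP'
    · rw [Function.update_of_ne hji]
      exact hS j (min_le_left _ _) (hq j)
  rcases h _ hmem with hsum | ⟨j, hj⟩
  · rw [Finset.sum_update_of_mem (Finset.mem_univ i)] at hsum
    linarith [le_max_right |R i| (B + 1 - ∑ j ∈ Finset.univ \ {i}, p₀ j)]
  · refine hj.not_gt (hR j _ ?_)
    rcases eq_or_ne j i with rfl | hji
    · rw [Function.update_self]
      exact (le_abs_self _).trans ((le_max_left _ _).trans (le_abs_self _))
    · rw [Function.update_of_ne hji]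
      linarith [neg_abs_le (p₀ j), le_abs_self (R j), min_le_right (q j) (-|R j|)]

/-- Otherwise each edge would have an interval of slopes along which both equations fail. The
Kirchhoff conditions of `U` and `W` say that the slopes `p i` in these intervals satisfy
`∑ p i ≤ B` and `B ≤ ∑ p i` respectively, which is impossible for all of them. -/
theorem exists_slope_nonpos_junction {ι : Type*} [Fintype ι] [Nonempty ι] {T τ σ B : ℝ}
    {f g : ι → ℝ → ℝ → ℝ → ℝ} {U W : ι → ℝ → ℝ → ℝ}
    (hm : ∀ i, IsTimeStrictMax T 0 τ σ (U i) (W i))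
    (hU : ∀ i, IsEdgeSubsolution T (f i) (U i)) (hW : ∀ i, IsEdgeSubsolution T (g i) (W i))
    (hf : ∀ i, ContinuousHamiltonian T (f i)) (hg : ∀ i, ContinuousHamiltonian T (g i))
    (hf' : ∀ i, PositiveAtLargeSlopes T (f i))
    (hJU : JunctionCondition B (fun i => f i τ 0) fun i => upperSlopes T τ (U i))
    (hJW : JunctionCondition (-B) (fun i => g i σ 0) fun i => upperSlopes T σ (W i)) :
    ∃ i p, f i τ 0 p ≤ 0 ∧ g i σ 0 (-p) ≤ 0 := by
  by_contra! hfg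
  have hbdd := hJU.bddAbove (fun _ => isLowerSet_upperSlopes)
    (fun i => have ⟨R, hR⟩ := hf' i
      (hU i).upperSlopes_nonempty (hm i).left_mem.1 (hm i).lt_of_ne hR)
    fun i => have ⟨R, hR⟩ := hf' i
      ⟨R, hR τ (Ioc_subset_Icc_self (hm i).left_mem) 0 le_rfl⟩
  choose l r hlr hint using fun i => (hm i).exists_slope_interval (hU i) (hW i) (hf i) (hg i)
    (hf' i) (hbdd i) (hfg i)
  choose p hlp hpr using fun i => exists_between (hlr i)
  choose q hpq hqr using fun i => exists_between (hpr i)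
  have hp := fun i => hint i (p i) ⟨hlp i, hpr i⟩
  have hq := fun i => hint i (q i) ⟨(hlp i).trans (hpq i), hqr i⟩
  have hqB : ∑ i, q i ≤ B := (hJU q fun i => (hq i).1).resolve_right fun ⟨i, hi⟩ =>
    hi.not_gt (hq i).2.2.1
  have hpB : ∑ i, -p i ≤ -B := (hJW _ fun i => (hp i).2.1).resolve_right fun ⟨i, hi⟩ =>
    hi.not_gt (hp i).2.2.2
  rw [Finset.sum_neg_distrib] at hpB
  have : ∑ i, p i < ∑ i, q i :=
    Finset.sum_lt_sum_of_nonempty Finset.univ_nonempty fun i _ => hpq i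
  linarith

end Junction

section Interior

variable {T x₀ τ σ : ℝ} {f g : ℝ → ℝ → ℝ → ℝ} {U W : ℝ → ℝ → ℝ}

theorem eventually_interior_of_neg_of_pos (hx₀ : x₀ < 0) (hτ : 0 < τ) :
    ∀ᶠ z : ℝ × ℝ in 𝓝 (x₀, τ), x₀ - 1 < z.1 ∧ z.1 < 0 ∧ 0 < z.2 := by
  have h₁ : ∀ᶠ z : ℝ × ℝ in 𝓝 (x₀, τ), z.1 ∈ Ioo (x₀ - 1) 0 :=
    continuous_fst.continuousAt.eventually (Ioo_mem_nhds (by simp) hx₀)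
  have h₂ : ∀ᶠ z : ℝ × ℝ in 𝓝 (x₀, τ), 0 < z.2 :=
    continuous_snd.continuousAt.eventually (lt_mem_nhds hτ)
  filter_upwards [h₁, h₂] with z hz₁ hz₂
  exact ⟨hz₁.1, hz₁.2, hz₂⟩

theorem IsTimeStrictMax.exists_isMaxOn_near (hm : IsTimeStrictMax T x₀ τ σ U W) (hx₀ : x₀ ≤ 0)
    (hU : UpperSemicontinuousOn (fun z : ℝ × ℝ => U z.1 z.2) (edgeCyl T))
    (hW : UpperSemicontinuousOn (fun z : ℝ × ℝ => W z.1 z.2) (edgeCyl T))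
    {N : Set ((ℝ × ℝ) × (ℝ × ℝ))} (hN : N ∈ 𝓝 ((x₀, τ), (x₀, σ))) :
    ∃ n : ℕ, ∃ z ∈ N, z ∈ (Icc (x₀ - 1) 0 ×ˢ Icc 0 T) ×ˢ (Icc (x₀ - 1) 0 ×ˢ Icc 0 T) ∧
      IsMaxOn (fun z : (ℝ × ℝ) × (ℝ × ℝ) => U z.1.1 z.1.2 + W z.2.1 z.2.2 - (z.1.1 - x₀) ^ 2
        - n * (z.1.1 - z.2.1) ^ 2)
        ((Icc (x₀ - 1) 0 ×ˢ Icc 0 T) ×ˢ (Icc (x₀ - 1) 0 ×ˢ Icc 0 T)) z := by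
  set Q : Set (ℝ × ℝ) := Icc (x₀ - 1) 0 ×ˢ Icc 0 T
  have hQ : IsCompact Q := isCompact_Icc.prod isCompact_Icc
  have hQT : Q ⊆ edgeCyl T := prod_mono (fun y hy => hy.2) subset_rfl
  have hbase : ((x₀, τ), (x₀, σ)) ∈ Q ×ˢ Q :=
    ⟨⟨⟨by linarith, hx₀⟩, Ioc_subset_Icc_self hm.left_mem⟩,
      ⟨⟨by linarith, hx₀⟩, Ioc_subset_Icc_self hm.right_mem⟩⟩
  have hΦ : UpperSemicontinuousOn (fun z : (ℝ × ℝ) × (ℝ × ℝ) =>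
      U z.1.1 z.1.2 + W z.2.1 z.2.2 - (z.1.1 - x₀) ^ 2) (Q ×ˢ Q) := by
    refine upperSemicontinuousOn_sub_continuousOn (.add ?_ ?_) (by fun_prop)
    · exact hU.comp (g := Prod.fst) continuous_fst.continuousOn fun z hz => hQT hz.1
    · exact hW.comp (g := Prod.snd) continuous_snd.continuousOn fun z hz => hQT hz.2
  have hlt : ∀ z ∈ (Q ×ˢ Q) \ interior N, (z.1.1 - z.2.1) ^ 2 = 0 →
      U z.1.1 z.1.2 + W z.2.1 z.2.2 - (z.1.1 - x₀) ^ 2 < U x₀ τ + W x₀ σ := by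
    rintro ⟨⟨x, t⟩, ⟨y, s⟩⟩ ⟨⟨⟨hx, ht⟩, -, hs⟩, hzN⟩ hxy
    obtain rfl : x = y := sub_eq_zero.1 (pow_eq_zero_iff two_ne_zero |>.1 hxy)
    rcases eq_or_ne x x₀ with rfl | hne
    · have : ¬(t = τ ∧ s = σ) := by
        rintro ⟨rfl, rfl⟩
        exact hzN (mem_interior_iff_mem_nhds.2 hN)
      simpa using fun h => this (hm.eq_of_le t ht s hs h)
    · have := sub_ne_zero.2 hne
      have : 0 < (x - x₀) ^ 2 := by positivity
      linarith [hm.le x hx.2 t ht s hs]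
  obtain ⟨n, hn⟩ := (eventually_forall_sub_mul_lt ((hQ.prod hQ).diff isOpen_interior)
    (hΦ.mono sdiff_subset) (ψ := fun z => (z.1.1 - z.2.1) ^ 2) (by fun_prop)
    (fun z _ => sq_nonneg _) hlt).exists
  obtain ⟨z, hz, hmax⟩ := (upperSemicontinuousOn_sub_continuousOn hΦ (g := fun z =>
    n * (z.1.1 - z.2.1) ^ 2) (by fun_prop)).exists_isMaxOn ⟨_, hbase⟩ (hQ.prod hQ)
  refine ⟨n, z, ?_, hz, hmax⟩
  by_contra hzN
  have := isMaxOn_iff.1 hmax _ hbase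
  have := hn z ⟨hz, fun h => hzN (interior_subset h)⟩
  simp only [sub_self] at *
  linarith

theorem IsEdgeSubsolution.nonpos_deriv_of_isMaxOn (hU : IsEdgeSubsolution T f U) {θ : ℝ → ℝ}
    (hθ : ContDiff ℝ 1 θ) {a : ℝ} {z : ℝ × ℝ} (hz : z ∈ Ioo a 0 ×ˢ Ioc 0 T)
    (hmax : IsMaxOn (fun z : ℝ × ℝ => U z.1 z.2 - θ z.1) (Icc a 0 ×ˢ Icc 0 T) z) :
    f z.2 z.1 (deriv θ z.1) ≤ 0 := by
  refine hU.edge θ hθ z.1 hz.1.2 z.2 hz.2 ?_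
  filter_upwards [eventually_fst_mem_nhdsWithin (Ioo_mem_nhds hz.1.1 hz.1.2) (edgeCyl T) z.2,
    self_mem_nhdsWithin] with w hw hw'
  exact hmax ⟨Ioo_subset_Icc_self hw, hw'.2⟩

theorem IsTimeStrictMax.frequently_exists_slope (hm : IsTimeStrictMax T x₀ τ σ U W)
    (hx₀ : x₀ < 0) (hU : IsEdgeSubsolution T f U) (hW : IsEdgeSubsolution T g W) :
    ∃ᶠ w : (ℝ × ℝ) × (ℝ × ℝ) × ℝ in 𝓝 ((x₀, τ), (x₀, σ), 0), w.1 ∈ edgeCyl T ∧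
      w.2.1 ∈ edgeCyl T ∧ ∃ p, f w.1.2 w.1.1 p ≤ 0 ∧ g w.2.1.2 w.2.1.1 (w.2.2 - p) ≤ 0 := by
  refine frequently_iff.2 fun {N} hN => ?_
  have hlim : Tendsto (fun v : (ℝ × ℝ) × (ℝ × ℝ) => (v.1, v.2, 2 * (v.1.1 - x₀)))
      (𝓝 ((x₀, τ), (x₀, σ))) (𝓝 ((x₀, τ), (x₀, σ), 0)) :=
    Continuous.tendsto' (by fun_prop) _ _ (by simp)
  obtain ⟨n, ⟨⟨x, t⟩, ⟨y, s⟩⟩, ⟨hzN, ⟨hx, hx', ht⟩, hy, hy', hs⟩, ⟨hz₁, hz₂⟩, hmax⟩ :=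
    hm.exists_isMaxOn_near hx₀.le hU.usc hW.usc ((hlim.eventually hN).and
      ((eventually_interior_of_neg_of_pos hx₀ hm.left_mem.1).prod_nhds
        (eventually_interior_of_neg_of_pos hx₀ hm.right_mem.1)))
  have hmax := isMaxOn_iff.1 hmax
  have hd₁ : deriv (fun z => (z - x₀) ^ 2 + n * (z - y) ^ 2) x
      = 2 * (x - x₀) + 2 * n * (x - y) :=
    (((hasDerivAt_id x).sub_const x₀ |>.pow 2).add
      (((hasDerivAt_id x).sub_const y |>.pow 2).const_mul (n : ℝ))).deriv.trans
        (by push_cast; dsimp only [id]; ring)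
  have hd₂ : deriv (fun z => n * (x - z) ^ 2) y = -(2 * n * (x - y)) :=
    (((hasDerivAt_id y).const_sub x |>.pow 2).const_mul (n : ℝ)).deriv.trans
      (by push_cast; dsimp only [id]; ring)
  have hf := hU.nonpos_deriv_of_isMaxOn (θ := fun z => (z - x₀) ^ 2 + n * (z - y) ^ 2)
    (by fun_prop) (z := (x, t)) ⟨⟨hx, hx'⟩, ht, hz₁.2.2⟩ fun z hz => by
      have := hmax (z, y, s) ⟨hz, hz₂⟩
      simp only [mem_ofPred_eq] at this ⊢
      linarith
  have hg := hW.nonpos_deriv_of_isMaxOn (θ := fun z => n * (x - z) ^ 2)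
    (by fun_prop) (z := (y, s)) ⟨⟨hy, hy'⟩, hs, hz₂.2.2⟩ fun z hz => by
      have := hmax ((x, t), z) ⟨hz₁, hz⟩
      simp only [mem_ofPred_eq] at this ⊢
      linarith
  refine ⟨_, hzN, ⟨hx'.le, hz₁.2⟩, ⟨hy'.le, hz₂.2⟩, _, hf, ?_⟩
  simp only [hd₁, hd₂] at hg ⊢
  convert hg using 2
  ring

theorem ContinuousHamiltonian.eventually_pos (hf : ContinuousHamiltonian T f) {t x p : ℝ}
    (ht : t ∈ Icc 0 T) (hx : x ≤ 0) (hp : 0 < f t x p) :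
    ∀ᶠ w : (ℝ × ℝ) × ℝ in 𝓝 ((x, t), p), w.1 ∈ edgeCyl T → 0 < f w.1.2 w.1.1 w.2 := by
  have hnear := eventually_nhdsWithin_iff.1
    ((hf (t, x, p) ⟨ht, hx, mem_univ _⟩).eventually (lt_mem_nhds hp))
  have hlim : Tendsto (fun w : (ℝ × ℝ) × ℝ => (w.1.2, w.1.1, w.2)) (𝓝 ((x, t), p))
      (𝓝 (t, x, p)) := Continuous.tendsto' (by fun_prop) _ _ rfl
  filter_upwards [hlim.eventually hnear] with w hw hmem
  exact hw ⟨hmem.2, hmem.1, mem_univ _⟩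

theorem exists_slope_nonpos_interior (hm : IsTimeStrictMax T x₀ τ σ U W) (hx₀ : x₀ < 0)
    (hU : IsEdgeSubsolution T f U) (hW : IsEdgeSubsolution T g W)
    (hf : ContinuousHamiltonian T f) (hg : ContinuousHamiltonian T g)
    (hf' : PositiveAtLargeSlopes T f) : ∃ p, f τ x₀ p ≤ 0 ∧ g σ x₀ (-p) ≤ 0 := by
  by_contra! hfg
  obtain ⟨R, hR⟩ := hf'
  have hnear : ∀ᶠ w : (ℝ × ℝ) × (ℝ × ℝ) × ℝ in 𝓝 ((x₀, τ), (x₀, σ), 0), ∀ p ∈ Icc (-R) R,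
      w.1 ∈ edgeCyl T → w.2.1 ∈ edgeCyl T →
        0 < f w.1.2 w.1.1 p ∨ 0 < g w.2.1.2 w.2.1.1 (w.2.2 - p) := by
    refine isCompact_Icc.eventually_forall_of_forall_eventually fun p _ => ?_
    rcases lt_or_ge 0 (f τ x₀ p) with hp | hp
    · have hlim : Tendsto (fun w : ((ℝ × ℝ) × (ℝ × ℝ) × ℝ) × ℝ => (w.1.1, w.2))
          (𝓝 (((x₀, τ), (x₀, σ), 0), p)) (𝓝 ((x₀, τ), p)) :=
        Continuous.tendsto' (by fun_prop) _ _ rfl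
      filter_upwards [hlim.eventually
        (hf.eventually_pos (Ioc_subset_Icc_self hm.left_mem) hx₀.le hp)] with w hw hw₁ _
      exact .inl (hw hw₁)
    · have hlim : Tendsto (fun w : ((ℝ × ℝ) × (ℝ × ℝ) × ℝ) × ℝ => (w.1.2.1, w.1.2.2 - w.2))
          (𝓝 (((x₀, τ), (x₀, σ), 0), p)) (𝓝 ((x₀, σ), -p)) :=
        Continuous.tendsto' (by fun_prop) _ _ (by simp)
      filter_upwards [hlim.eventually
        (hg.eventually_pos (Ioc_subset_Icc_self hm.right_mem) hx₀.le (hfg p hp))] with w hw _ hw₂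
      exact .inr (hw hw₂)
  obtain ⟨w, ⟨hw₁, hw₂, p, hfp, hgp⟩, hw⟩ :=
    ((hm.frequently_exists_slope hx₀ hU hW).and_eventually hnear).exists
  have hpR : |p| < R := not_le.1 fun h => hfp.not_gt (hR _ hw₁.2 _ hw₁.1 _ h)
  exact (hw p (abs_le.1 hpR.le) hw₁ hw₂).elim hfp.not_gt hgp.not_gt

end Interior

section TimeDoubling

/-- The parabola with value `0` and slope `l` at `τ`, and second derivative `4 / ε`. It touches the
penalty `(t - s)² / (2 ε)` from above with a gap, which makes maxima strict in time. -/
noncomputable def timeParabola (ε l τ t : ℝ) : ℝ :=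
  l * (t - τ) + 2 / ε * (t - τ) ^ 2

/-- The maximum over the network of `u i x t + w i x s - (t - s)² / (2 ε)`, only the time variable
being doubled, is attained at `(i₀, x₀, τ, σ)`. -/
def IsDoubledMax {K : ℕ} (T ε : ℝ) (u w : Fin K → ℝ → ℝ → ℝ) (i₀ : Fin K) (x₀ τ σ : ℝ) : Prop :=
  ∀ i, ∀ x ≤ (0 : ℝ), ∀ t ∈ Icc 0 T, ∀ s ∈ Icc 0 T,
    u i x t + w i x s - (t - s) ^ 2 / (2 * ε) ≤ u i₀ x₀ τ + w i₀ x₀ σ - (τ - σ) ^ 2 / (2 * ε)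

variable {T ε τ σ : ℝ}

theorem contDiff_timeParabola (ε l τ : ℝ) : ContDiff ℝ 1 (timeParabola ε l τ) := by
  unfold timeParabola
  fun_prop

theorem timeParabola_self (ε l τ : ℝ) : timeParabola ε l τ τ = 0 := by
  simp [timeParabola]

theorem deriv_timeParabola_self (ε l τ : ℝ) : deriv (timeParabola ε l τ) τ = l :=
  ((((hasDerivAt_id τ).sub_const τ).const_mul l).add
    ((((hasDerivAt_id τ).sub_const τ).pow 2).const_mul (2 / ε))).deriv.trans (by simp)

theorem sq_div_add_sq_div_le_timeParabola (hε : 0 < ε) (τ σ t s : ℝ) :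
    (t - s) ^ 2 / (2 * ε) - (τ - σ) ^ 2 / (2 * ε) + ((t - τ) ^ 2 + (s - σ) ^ 2) / ε ≤
      timeParabola ε ((τ - σ) / ε) τ t + timeParabola ε (-((τ - σ) / ε)) σ s := by
  have hgap : timeParabola ε ((τ - σ) / ε) τ t + timeParabola ε (-((τ - σ) / ε)) σ s =
      (t - s) ^ 2 / (2 * ε) - (τ - σ) ^ 2 / (2 * ε) + ((t - τ) ^ 2 + (s - σ) ^ 2) / ε +
        ((t - τ) + (s - σ)) ^ 2 / (2 * ε) := by
    simp only [timeParabola]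
    field_simp
    ring
  have : 0 ≤ ((t - τ) + (s - σ)) ^ 2 / (2 * ε) := by positivity
  linarith

theorem isTimeStrictMax_sub_timeParabola (hε : 0 < ε) (hτ : τ ∈ Ioc 0 T) (hσ : σ ∈ Ioc 0 T)
    {U W : ℝ → ℝ → ℝ} {x₀ : ℝ} (hx₀ : x₀ ≤ 0)
    (hmax : ∀ x ≤ (0 : ℝ), ∀ t ∈ Icc 0 T, ∀ s ∈ Icc 0 T,
      U x t + W x s - (t - s) ^ 2 / (2 * ε) ≤ U x₀ τ + W x₀ σ - (τ - σ) ^ 2 / (2 * ε)) :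
    IsTimeStrictMax T x₀ τ σ (fun x t => U x t - timeParabola ε ((τ - σ) / ε) τ t)
      (fun x s => W x s - timeParabola ε (-((τ - σ) / ε)) σ s) := by
  have hgap : ∀ x ≤ (0 : ℝ), ∀ t ∈ Icc 0 T, ∀ s ∈ Icc 0 T,
      U x t - timeParabola ε ((τ - σ) / ε) τ t + (W x s - timeParabola ε (-((τ - σ) / ε)) σ s) +
        ((t - τ) ^ 2 + (s - σ) ^ 2) / ε ≤ U x₀ τ + W x₀ σ := fun x hx t ht s hs => by
    linarith [hmax x hx t ht s hs, sq_div_add_sq_div_le_timeParabola hε τ σ t s]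
  refine ⟨hτ, hσ, fun x hx t ht s hs => ?_, fun t ht s hs hle => ?_⟩
  · have : 0 ≤ ((t - τ) ^ 2 + (s - σ) ^ 2) / ε := by positivity
    simp only [timeParabola_self]
    linarith [hgap x hx t ht s hs]
  · simp only [timeParabola_self] at hle
    have hzero : ((t - τ) ^ 2 + (s - σ) ^ 2) / ε ≤ 0 := by linarith [hgap x₀ hx₀ t ht s hs]
    rw [div_le_iff₀ hε, zero_mul] at hzero
    constructor <;> nlinarith [sq_nonneg (t - τ), sq_nonneg (s - σ)]

theorem ContinuousHamiltonian.deriv_add {f : ℝ → ℝ → ℝ → ℝ} (hf : ContinuousHamiltonian T f)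
    {ψ : ℝ → ℝ} (hψ : ContDiff ℝ 1 ψ) :
    ContinuousHamiltonian T fun t x p => deriv ψ t + f t x p :=
  ((hψ.continuous_deriv le_rfl).comp continuous_fst).continuousOn.add hf

variable {K : ℕ} {B : ℝ} {F G : Fin K → ℝ → ℝ → ℝ → ℝ} {u w : Fin K → ℝ → ℝ → ℝ}

theorem HamiltonianCoercive.positiveAtLargeSlopes_deriv_add (hF : HamiltonianCoercive T F)
    {ψ : ℝ → ℝ} (hψ : ContDiff ℝ 1 ψ) (i : Fin K) :
    PositiveAtLargeSlopes T fun t x p => deriv ψ t + F i t x p := by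
  obtain ⟨m, hm⟩ := isCompact_Icc.bddBelow_image (K := Icc 0 T)
    (hψ.continuous_deriv le_rfl).continuousOn
  obtain ⟨R, hR⟩ := hF i (1 - m)
  exact ⟨R, fun t ht x hx p hp => by linarith [hR t ht x hx p hp, hm (mem_image_of_mem _ ht)]⟩

theorem IsSeparableSubsolution.isEdgeSubsolution (hu : IsSeparableSubsolution T B F u)
    {ψ : ℝ → ℝ} (hψ : ContDiff ℝ 1 ψ) (i : Fin K) :
    IsEdgeSubsolution T (fun t x p => deriv ψ t + F i t x p) (fun x t => u i x t - ψ t) where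
  usc := by
    have := hψ.continuous
    exact upperSemicontinuousOn_sub_continuousOn (hu.usc i) (by fun_prop)
  edge θ hθ x hx t ht hm := hu.edge θ ψ hθ hψ i x hx t ht (by
    filter_upwards [hm] with z hz
    linarith)

theorem IsSeparableSubsolution.junctionCondition (hu : IsSeparableSubsolution T B F u)
    {ψ : ℝ → ℝ} (hψ : ContDiff ℝ 1 ψ) (hτ : τ ∈ Ioc 0 T)
    (hmax : ∀ i, ∀ t ∈ Icc 0 T, t ≠ τ → u i 0 t - ψ t < u i 0 τ - ψ τ) :
    JunctionCondition B (fun i p => deriv ψ τ + F i τ 0 p)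
      fun i => upperSlopes T τ fun x t => u i x t - ψ t := fun p hp => by
  have hd : ∀ i, deriv (fun x => p i * x) 0 = p i := fun i => by simp
  have := hu.junction (fun i x => p i * x) ψ (fun i => by fun_prop) hψ (fun i j => by simp) τ hτ
    fun i => by
      filter_upwards [eventually_fst_mem_nhdsWithin (eventually_nhdsWithin_iff.1 (hp i))
        (edgeCyl T) τ, self_mem_nhdsWithin] with z hz ⟨hx, ht⟩
      rcases lt_or_eq_of_le (show z.1 ≤ 0 from hx) with hx | hx
      · have : u i z.1 z.2 - ψ z.2 ≤ u i 0 τ - ψ τ + p i * z.1 := hz hx z.2 ht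
        linarith
      · rw [hx]
        rcases eq_or_ne z.2 τ with h | h
        · rw [h]
        · linarith [hmax i z.2 ht h]
  simpa only [hd] using this

theorem IsDoubledMax.exists_slope {i₀ : Fin K} {x₀ : ℝ}
    (hmax : IsDoubledMax T ε u w i₀ x₀ τ σ) (hε : 0 < ε)
    (hu : IsSeparableSubsolution T B F u) (hw : IsSeparableSubsolution T (-B) G w)
    (hF : ∀ i, ContinuousHamiltonian T (F i)) (hG : ∀ i, ContinuousHamiltonian T (G i))
    (hF' : HamiltonianCoercive T F) (hx₀ : x₀ ≤ 0) (hτ : τ ∈ Ioc 0 T) (hσ : σ ∈ Ioc 0 T) :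
    ∃ i p, (τ - σ) / ε + F i τ x₀ p ≤ 0 ∧ -((τ - σ) / ε) + G i σ x₀ (-p) ≤ 0 := by
  have : Nonempty (Fin K) := ⟨i₀⟩
  set ψ := timeParabola ε ((τ - σ) / ε) τ
  set χ := timeParabola ε (-((τ - σ) / ε)) σ
  have hψ : ContDiff ℝ 1 ψ := contDiff_timeParabola ..
  have hχ : ContDiff ℝ 1 χ := contDiff_timeParabola ..
  have hdψ : deriv ψ τ = (τ - σ) / ε := deriv_timeParabola_self ..
  have hdχ : deriv χ σ = -((τ - σ) / ε) := deriv_timeParabola_self ..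
  suffices ∃ i p, deriv ψ τ + F i τ x₀ p ≤ 0 ∧ deriv χ σ + G i σ x₀ (-p) ≤ 0 by
    simpa only [hdψ, hdχ] using this
  rcases hx₀.lt_or_eq with hx₀ | rfl
  · exact ⟨i₀, exists_slope_nonpos_interior
      (isTimeStrictMax_sub_timeParabola hε hτ hσ hx₀.le (hmax i₀)) hx₀
      (hu.isEdgeSubsolution hψ i₀) (hw.isEdgeSubsolution hχ i₀) ((hF i₀).deriv_add hψ)
      ((hG i₀).deriv_add hχ) (hF'.positiveAtLargeSlopes_deriv_add hψ i₀)⟩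
  · have hm : ∀ i, IsTimeStrictMax T 0 τ σ (fun x t => u i x t - ψ t)
        (fun x s => w i x s - χ s) := fun i => by
      refine isTimeStrictMax_sub_timeParabola hε hτ hσ le_rfl ?_
      rw [hu.glued i i₀ τ (Ioc_subset_Icc_self hτ), hw.glued i i₀ σ (Ioc_subset_Icc_self hσ)]
      exact hmax i
    exact exists_slope_nonpos_junction hm (hu.isEdgeSubsolution hψ) (hw.isEdgeSubsolution hχ)
      (fun i => (hF i).deriv_add hψ) (fun i => (hG i).deriv_add hχ)
      (hF'.positiveAtLargeSlopes_deriv_add hψ)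
      (hu.junctionCondition hψ hτ fun i => (hm i).lt_of_ne)
      (hw.junctionCondition hχ hσ fun i => (hm i).symm.lt_of_ne)

end TimeDoubling

section HamiltonianBounds

variable {K : ℕ} {T B : ℝ} {H : Fin K → ℝ → ℝ → ℝ → ℝ} {u : Fin K → ℝ → ℝ → ℝ}

/-- Each `F_i` is bounded below on `[0, T] × (-∞, 0] × [-R, R]`, for every `R`. -/
def HamiltonianBddBelow {K : ℕ} (T : ℝ) (F : Fin K → ℝ → ℝ → ℝ → ℝ) : Prop :=
  ∀ i R, ∃ C, ∀ t ∈ Icc 0 T, ∀ x ≤ (0 : ℝ), ∀ p, |p| ≤ R → -C ≤ F i t x p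

theorem HamiltonianLipschitz.exists_abs_sub_le (hLip : HamiltonianLipschitz T H) (i : Fin K)
    (r R : ℝ) :
    ∃ D, ∀ t ∈ Icc 0 T, ∀ s ∈ Icc 0 T, ∀ x ≤ (0 : ℝ), ∀ y ≤ (0 : ℝ), ∀ p q : ℝ, |x - y| ≤ r →
      |p| ≤ R → |q| ≤ R → |H i t x p - H i s y q| ≤ D := by
  obtain ⟨L, hL⟩ := hLip i (max R 1) (by positivity)
  refine ⟨|L| * (T + r + 2 * R), fun t ht s hs x hx y hy p q hxy hp hq => ?_⟩
  refine (hL t ht s hs x hx y hy p q (hp.trans (le_max_left _ _))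
    (hq.trans (le_max_left _ _))).trans
    (mul_le_mul (le_abs_self L) ?_ (by positivity) (abs_nonneg _))
  have hts : |t - s| ≤ T := abs_le.2 ⟨by linarith [ht.1, hs.2], by linarith [ht.2, hs.1]⟩
  linarith [abs_sub p q]

theorem HamiltonianLipschitz.hamiltonianBddBelow (hLip : HamiltonianLipschitz T H)
    (hCoer : HamiltonianCoercive T H) : HamiltonianBddBelow T H := fun i R => by
  obtain ⟨R₀, hR₀⟩ := hCoer i 0
  obtain ⟨D, hD⟩ := hLip.exists_abs_sub_le i 0 (max |R₀| R)
  refine ⟨D, fun t ht x hx p hp => ?_⟩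
  have hosc := hD t ht t ht x hx x hx p R₀ (by simp) (hp.trans (le_max_right _ _))
    (le_max_left _ _)
  linarith [hR₀ t ht x hx R₀ (le_abs_self R₀), (abs_le.1 hosc).1]

/-- Otherwise a steep parabola in space plus a decreasing line in time would touch `u` from above
at a place where the equation fails. -/
theorem IsSeparableSubsolution.exists_hamiltonian_le (hT : 0 < T)
    (hu : IsSeparableSubsolution T B H u) (i : Fin K) {M : ℝ}
    (hM : ∀ x ≤ (0 : ℝ), ∀ t ∈ Icc 0 T, |u i x t| ≤ M) {x : ℝ} (hx : x ≤ 0) :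
    ∃ t ∈ Icc 0 T, ∃ y ∈ Icc (x - 2) x, ∃ p, H i t y p ≤ (4 * M + 2) / T := by
  have hT' : T ∈ Icc 0 T := ⟨hT.le, le_rfl⟩
  have hM0 : 0 ≤ M := (abs_nonneg _).trans (hM x hx T hT')
  set A := (4 * M + 2) / T
  have hAT : A * T = 4 * M + 2 := div_mul_cancel₀ _ hT.ne'
  let θ : ℝ → ℝ := fun y => 3 * M + 2 + (2 * M + 1) * (y - (x - 1)) ^ 2
  have hlateral : ∀ y ≤ (0 : ℝ), (y - (x - 1)) ^ 2 = 1 → ∀ t ∈ Icc 0 T, u i y t - -A * t < θ y :=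
    fun y hy hyx t ht => by
      have : A * t ≤ A * T := mul_le_mul_of_nonneg_left ht.2 (by positivity)
      simp only [θ, hyx]
      linarith [(abs_le.1 (hM y hy t ht)).2]
  have hcenter : θ (x - 1) ≤ u i (x - 1) T - -A * T := by
    simp only [θ, sub_self]
    linarith [(abs_le.1 (hM (x - 1) (by linarith) T hT')).1]
  obtain ⟨y, hy, t, ht, htouch, hle⟩ :=
    (hu.isEdgeSubsolution (ψ := fun t => -A * t) (by fun_prop) i).exists_touch (θ := θ)
      (a := x - 2) (x₁ := x - 1) (by fun_prop) hx ⟨by linarith, by linarith⟩ hT'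
      (hlateral _ (by linarith) (by ring)) (hlateral _ hx (by ring)) hcenter
  have ht0 : 0 < t := ht.1.lt_of_ne fun h0 => by
    subst h0
    have : 0 ≤ (2 * M + 1) * (y - (x - 1)) ^ 2 := by positivity
    simp only [θ] at htouch
    linarith [(abs_le.1 (hM y (hy.2.le.trans hx) 0 ht)).2]
  have hdt : deriv (fun t : ℝ => -A * t) t = -A := by simp
  exact ⟨t, ht, y, Ioo_subset_Icc_self hy, deriv θ y, by linarith [hle ht0]⟩

theorem IsSeparableSubsolution.hamiltonianBddBelow_reflectedHamiltonian (hT : 0 < T)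
    (hLip : HamiltonianLipschitz T H) (hCoer : HamiltonianCoercive T H)
    (hu : IsSeparableSubsolution T B H u) (hub : BoundedOnNetwork T u) :
    HamiltonianBddBelow T (reflectedHamiltonian H) := fun i R => by
  obtain ⟨M, hM⟩ := hub
  set A := (4 * M + 2) / T
  obtain ⟨R₀, hR₀⟩ := hCoer i (A + 1)
  obtain ⟨D, hD⟩ := hLip.exists_abs_sub_le i 2 (max R₀ R)
  refine ⟨A + D, fun t ht x hx p hp => ?_⟩
  obtain ⟨s, hs, y, hy, q, hq⟩ := hu.exists_hamiltonian_le hT i (hM i) hx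
  have hy0 : y ≤ 0 := hy.2.trans hx
  have hqR : |q| ≤ R₀ := by
    by_contra! hlt
    linarith [hR₀ s hs y hy0 q hlt.le]
  have hosc := hD t ht s hs x hx y hy0 (-p) q (abs_le.2 ⟨by linarith [hy.2], by linarith [hy.1]⟩)
    ((abs_neg p).trans_le (hp.trans (le_max_right _ _))) (hqR.trans (le_max_left _ _))
  simp only [reflectedHamiltonian]
  linarith [(abs_le.1 hosc).2]

end HamiltonianBounds

section InitialLayer

variable {K : ℕ} {T B : ℝ} {F : Fin K → ℝ → ℝ → ℝ → ℝ} {u : Fin K → ℝ → ℝ → ℝ}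

theorem IsSeparableSubsolution.le_of_strict_supersolution (hu : IsSeparableSubsolution T B F u)
    {θ : Fin K → ℝ → ℝ} {ψ : ℝ → ℝ} (hθ : ∀ i, ContDiff ℝ 1 (θ i)) (hψ : ContDiff ℝ 1 ψ)
    (h0 : ∀ i j, θ i 0 = θ j 0) (hinit : ∀ i, ∀ x ≤ (0 : ℝ), u i x 0 ≤ θ i x + ψ 0) {r : ℝ}
    (hfar : ∀ i, ∀ x ≤ (0 : ℝ), x < r → ∀ t ∈ Icc 0 T, u i x t ≤ θ i x + ψ t)
    (hsuper : ∀ i, ∀ x ≤ (0 : ℝ), ∀ t ∈ Ioc 0 T, θ i x + ψ t < u i x t →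
      0 < deriv ψ t + F i t x (deriv (θ i) x))
    (hjunction : ∀ i, ∀ t ∈ Ioc 0 T, θ i 0 + ψ t < u i 0 t → B < ∑ k, deriv (θ k) 0) :
    ∀ i, ∀ x ≤ (0 : ℝ), ∀ t ∈ Icc 0 T, u i x t ≤ θ i x + ψ t := by
  by_contra! hcon
  obtain ⟨i₀, x₀, hx₀, t₀, ht₀, hlt⟩ := hcon
  have husc : ∀ i, UpperSemicontinuousOn
      (fun z : ℝ × ℝ => u i z.1 z.2 - (θ i z.1 + ψ z.2)) (edgeCyl T) := fun i => by
    have := (hθ i).continuous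
    have := hψ.continuous
    exact upperSemicontinuousOn_sub_continuousOn (hu.usc i) (by fun_prop)
  obtain ⟨i, ⟨x, t⟩, ⟨hx, ht⟩, hmax⟩ := exists_forall_le_of_lt_outside_compact
    (C := Icc r 0 ×ˢ Icc 0 T) (isCompact_Icc.prod isCompact_Icc)
    (prod_mono Icc_subset_Iic_self subset_rfl) husc (i₀ := i₀) (x₀ := (x₀, t₀)) ⟨hx₀, ht₀⟩
    fun i z hz hzC => by
      have hzr : z.1 < r := by
        by_contra! hge
        exact hzC ⟨⟨hge, hz.1⟩, hz.2⟩
      linarith [hfar i z.1 hz.1 hzr z.2 hz.2]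
  have hpos : θ i x + ψ t < u i x t := by linarith [hmax i₀ (x₀, t₀) ⟨hx₀, ht₀⟩]
  have ht0 : t ∈ Ioc 0 T := by
    refine ⟨ht.1.lt_of_ne ?_, ht.2⟩
    rintro rfl
    exact hpos.not_ge (hinit i x hx.2)
  rcases hx.2.lt_or_eq with hx0 | rfl
  · refine (hsuper i x hx.2 t ht0 hpos).not_ge
      (hu.edge (θ i) ψ (hθ i) hψ i x hx0 t ht0 ?_)
    filter_upwards [self_mem_nhdsWithin] with z hz using hmax i z hz
  · have hmax0 : ∀ k, θ k 0 + ψ t < u k 0 t := fun k => by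
      rwa [h0 k i, hu.glued k i t ht]
    have htest := hu.junction θ ψ hθ hψ h0 t ht0 fun k => by
      filter_upwards [self_mem_nhdsWithin] with z hz
      simpa only [h0 k i, hu.glued k i t ht] using hmax k z hz
    rcases htest with hsum | ⟨k, hk⟩
    · exact hsum.not_gt (hjunction i t ht0 hpos)
    · exact hk.not_gt (hsuper k 0 le_rfl t ht0 (hmax0 k))

/-- The position of the point `(i, x)` on the line made of the edge `j`, as `(-∞, 0]`, and, when
`i ≠ j`, the edge `i`, as `[0, ∞)`: its distance to `y ≤ 0` is the path distance from `(i, x)` to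
`(j, y)`. -/
def unfoldedPosition {K : ℕ} (i : Fin K) (x : ℝ) (j : Fin K) : ℝ :=
  if j = i then x else -x

/-- The space part of the barrier centred at `(i, x)`. The exponential raises all the slopes at the
junction by `P`, to meet the Kirchhoff condition, at the cost of an error at most `κ`. -/
noncomputable def initialBarrier {K : ℕ} (C κ P : ℝ) (i : Fin K) (x : ℝ) (j : Fin K) (y : ℝ) : ℝ :=
  C * (y - unfoldedPosition i x j) ^ 2 + κ * Real.exp (P * y / κ)

variable {C κ P D x y : ℝ} {i j : Fin K}

theorem sq_unfoldedPosition (i : Fin K) (x : ℝ) (j : Fin K) :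
    unfoldedPosition i x j ^ 2 = x ^ 2 := by
  unfold unfoldedPosition
  split_ifs <;> ring

theorem le_unfoldedPosition (hx : x ≤ 0) (i j : Fin K) : x ≤ unfoldedPosition i x j := by
  unfold unfoldedPosition
  split_ifs <;> linarith

theorem contDiff_initialBarrier (C κ P : ℝ) (i : Fin K) (x : ℝ) (j : Fin K) :
    ContDiff ℝ 1 (initialBarrier C κ P i x j) := by
  unfold initialBarrier
  fun_prop

theorem initialBarrier_zero (C κ P : ℝ) (i : Fin K) (x : ℝ) (j : Fin K) :
    initialBarrier C κ P i x j 0 = C * x ^ 2 + κ := by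
  simp [initialBarrier, sq_unfoldedPosition]

theorem mul_sq_le_initialBarrier (hκ : 0 ≤ κ) (C P : ℝ) (i : Fin K) (x : ℝ) (j : Fin K) (y : ℝ) :
    C * (y - unfoldedPosition i x j) ^ 2 ≤ initialBarrier C κ P i x j y :=
  le_add_of_nonneg_right (by positivity)

theorem exp_mul_div_le_one (hκ : 0 ≤ κ) (hP : 0 ≤ P) (hy : y ≤ 0) : Real.exp (P * y / κ) ≤ 1 :=
  Real.exp_le_one_iff.2
    (div_nonpos_of_nonpos_of_nonneg (mul_nonpos_of_nonneg_of_nonpos hP hy) hκ)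

theorem initialBarrier_self_le (hκ : 0 ≤ κ) (hP : 0 ≤ P) (hx : x ≤ 0) (C : ℝ) (i : Fin K) :
    initialBarrier C κ P i x i x ≤ κ := by
  simpa [initialBarrier, unfoldedPosition] using
    mul_le_of_le_one_right hκ (exp_mul_div_le_one hκ hP hx)

theorem deriv_initialBarrier (hκ : κ ≠ 0) (C P : ℝ) (i : Fin K) (x : ℝ) (j : Fin K) (y : ℝ) :
    deriv (initialBarrier C κ P i x j) y =
      2 * C * (y - unfoldedPosition i x j) + P * Real.exp (P * y / κ) :=
  ((((hasDerivAt_id y).sub_const (unfoldedPosition i x j)).pow 2).const_mul C |>.add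
    ((((hasDerivAt_id y).const_mul P).div_const κ).exp.const_mul κ)).deriv.trans (by
      simp
      field_simp)

theorem abs_deriv_initialBarrier_le (hC : 0 ≤ C) (hκ : 0 < κ) (hP : 0 ≤ P) (hy : y ≤ 0)
    (hD : |y - unfoldedPosition i x j| ≤ D) :
    |deriv (initialBarrier C κ P i x j) y| ≤ 2 * C * D + P := by
  rw [deriv_initialBarrier hκ.ne']
  refine (abs_add_le _ _).trans (add_le_add ?_ ?_)
  · rw [abs_mul, abs_of_nonneg (by positivity)]
    exact mul_le_mul_of_nonneg_left hD (by positivity)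
  · rw [abs_of_nonneg (by positivity)]
    exact mul_le_of_le_one_right hP (exp_mul_div_le_one hκ.le hP hy)

theorem sub_le_deriv_initialBarrier_zero (hC : 0 ≤ C) (hκ : 0 < κ) (hD : |x| ≤ D) (P : ℝ)
    (i j : Fin K) : P - 2 * C * D ≤ deriv (initialBarrier C κ P i x j) 0 := by
  have hle : unfoldedPosition i x j ≤ D :=
    (le_abs_self _).trans
      ((sq_eq_sq_iff_abs_eq_abs _ _).1 (sq_unfoldedPosition i x j) |>.trans_le hD)
  have : 2 * C * unfoldedPosition i x j ≤ 2 * C * D := mul_le_mul_of_nonneg_left hle (by positivity)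
  rw [deriv_initialBarrier hκ.ne', mul_zero, zero_div, Real.exp_zero]
  linarith

theorem IsSeparableSubsolution.le_add_initialBarrier (hu : IsSeparableSubsolution T B F u)
    {M A c : ℝ} (hx : x ≤ 0) (hC : 0 < C) (hκ : 0 < κ) (hD : 0 ≤ D) (hA : 0 ≤ A)
    (hub : ∀ j, ∀ y ≤ (0 : ℝ), ∀ t ∈ Icc 0 T, u j y t ≤ M)
    (hinit : ∀ j, ∀ y ≤ (0 : ℝ), u j y 0 ≤ c + C * (y - unfoldedPosition i x j) ^ 2)
    (hCD : M ≤ c + C * D ^ 2) (hP : |B| + 2 * C * D < P)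
    (hF : ∀ j, ∀ t ∈ Icc 0 T, ∀ y ≤ (0 : ℝ), ∀ p, |p| ≤ 2 * C * D + P → -A < F j t y p) :
    ∀ j, ∀ y ≤ (0 : ℝ), ∀ t ∈ Icc 0 T, u j y t ≤ c + initialBarrier C κ P i x j y + A * t := by
  have hP0 : 0 ≤ P := by linarith [abs_nonneg B, mul_nonneg (mul_pos two_pos hC).le hD]
  have hdt : ∀ t, deriv (fun s => A * s) t = A := fun t => by simp
  have hdx : ∀ j, deriv (fun y => c + initialBarrier C κ P i x j y) =
      deriv (initialBarrier C κ P i x j) := fun j => funext fun y => deriv_const_add _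
  have hnear : ∀ j, ∀ y ≤ (0 : ℝ), ∀ t ∈ Icc 0 T,
      c + initialBarrier C κ P i x j y + A * t < u j y t → |y - unfoldedPosition i x j| ≤ D :=
    fun j y hy t ht hlt => by
      have : C * (y - unfoldedPosition i x j) ^ 2 ≤ C * D ^ 2 := by
        linarith [hub j y hy t ht, mul_sq_le_initialBarrier hκ.le C P i x j y,
          mul_nonneg hA ht.1]
      exact abs_le_of_sq_le_sq (le_of_mul_le_mul_left this hC) hD
  refine hu.le_of_strict_supersolution (θ := fun j y => c + initialBarrier C κ P i x j y)
    (ψ := fun t => A * t) (r := x - D)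
    (fun j => contDiff_const.add (contDiff_initialBarrier C κ P i x j)) (by fun_prop)
    (fun j k => by simp only [initialBarrier_zero]) (fun j y hy => ?_)
    (fun j y hy hyr t ht => ?_) (fun j y hy t ht hlt => ?_) (fun j t ht hlt => ?_)
  · linarith [hinit j y hy, mul_sq_le_initialBarrier hκ.le C P i x j y]
  · by_contra! hlt
    linarith [neg_le_of_abs_le (hnear j y hy t ht hlt), le_unfoldedPosition hx i j]
  · have ht' := Ioc_subset_Icc_self ht
    rw [hdt, hdx]
    linarith [hF j t ht' y hy _
      (abs_deriv_initialBarrier_le hC.le hκ hP0 hy (hnear j y hy t ht' hlt))]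
  · have hxD : |x| ≤ D := by
      rw [← (sq_eq_sq_iff_abs_eq_abs _ _).1 (sq_unfoldedPosition i x j), ← abs_neg, ← zero_sub]
      exact hnear j 0 le_rfl t (Ioc_subset_Icc_self ht) hlt
    have hslope : ∀ k, |B| < deriv (initialBarrier C κ P i x k) 0 := fun k => by
      linarith [sub_le_deriv_initialBarrier_zero hC.le hκ hxD P i k]
    simp only [hdx]
    exact (le_abs_self B).trans_lt ((hslope j).trans_le (Finset.single_le_sum
      (fun k _ => (abs_nonneg B).trans (hslope k).le) (Finset.mem_univ j)))

/-- A bounded uniformly continuous function on the network. -/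
structure IsNetworkDatum {K : ℕ} (h : Fin K → ℝ → ℝ) : Prop where
  bounded : ∃ M, ∀ i, ∀ x ≤ (0 : ℝ), |h i x| ≤ M
  glued : ∀ i j, h i 0 = h j 0
  uniformContinuousOn : ∀ i, UniformContinuousOn (h i) (Iic 0)

theorem IsNetworkDatum.const_sub {h : Fin K → ℝ → ℝ} (hh : IsNetworkDatum h) (m : ℝ) :
    IsNetworkDatum fun i x => m - h i x where
  bounded := by
    obtain ⟨M, hM⟩ := hh.bounded
    exact ⟨|m| + M, fun i x hx => (abs_sub _ _).trans (by linarith [hM i x hx])⟩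
  glued i j := by rw [hh.glued i j]
  uniformContinuousOn i :=
    (uniformContinuous_const.sub uniformContinuous_id).comp_uniformContinuousOn
      (hh.uniformContinuousOn i)

theorem exists_sub_le_add_mul_sq {h : ℝ → ℝ} {s : Set ℝ} (hκ : 0 < κ)
    (hb : ∃ M, ∀ x ∈ s, |h x| ≤ M) (hc : UniformContinuousOn h s) :
    ∃ C, ∀ x ∈ s, ∀ y ∈ s, h x - h y ≤ κ + C * (x - y) ^ 2 := by
  obtain ⟨M, hM⟩ := hb
  obtain ⟨δ, hδ, hlt⟩ := Metric.uniformContinuousOn_iff.1 hc κ hκ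
  refine ⟨2 * |M| / δ ^ 2, fun x hx y hy => ?_⟩
  rcases lt_or_ge (dist x y) δ with hxy | hxy
  · have : 0 ≤ 2 * |M| / δ ^ 2 * (x - y) ^ 2 := by positivity
    linarith [le_abs_self (h x - h y), hlt x hx y hy hxy, Real.dist_eq (h x) (h y)]
  · have hsq : 1 ≤ (x - y) ^ 2 / δ ^ 2 := by
      rw [one_le_div (by positivity), ← sq_abs (x - y), ← Real.dist_eq]
      exact pow_le_pow_left₀ hδ.le hxy 2
    have : 2 * |M| ≤ 2 * |M| / δ ^ 2 * (x - y) ^ 2 :=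
      (le_mul_of_one_le_right (by positivity) hsq).trans_eq (by ring)
    linarith [(abs_le.1 (hM x hx)).2, (abs_le.1 (hM y hy)).1, le_abs_self M]

theorem IsNetworkDatum.exists_le_add_mul_sq {h : Fin K → ℝ → ℝ} (hh : IsNetworkDatum h)
    (hκ : 0 < κ) : ∃ C > 0, ∀ i, ∀ x ≤ (0 : ℝ), ∀ j, ∀ y ≤ (0 : ℝ),
      h j y ≤ h i x + κ + C * (y - unfoldedPosition i x j) ^ 2 := by
  obtain ⟨M, hM⟩ := hh.bounded
  choose C' hC' using fun i => exists_sub_le_add_mul_sq (half_pos hκ) ⟨M, hM i⟩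
    (hh.uniformContinuousOn i)
  obtain ⟨C₁, hC₁⟩ := Finite.exists_le C'
  have hmod : ∀ i, ∀ x ≤ (0 : ℝ), ∀ y ≤ (0 : ℝ),
      h i x - h i y ≤ κ / 2 + max C₁ 1 * (x - y) ^ 2 := fun i x hx y hy => by
    have hC : C' i ≤ max C₁ 1 := (hC₁ i).trans (le_max_left _ _)
    linarith [hC' i x hx y hy, mul_le_mul_of_nonneg_right hC (sq_nonneg (x - y))]
  refine ⟨max C₁ 1, by positivity, fun i x hx j y hy => ?_⟩
  rcases eq_or_ne j i with rfl | hji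
  · rw [unfoldedPosition, if_pos rfl]
    linarith [hmod j y hy x hx]
  · rw [unfoldedPosition, if_neg hji]
    have hjunction := hh.glued j i
    have hcross : 0 ≤ max C₁ 1 * (x * y) :=
      mul_nonneg (by positivity) (mul_nonneg_of_nonpos_of_nonpos hx hy)
    linarith [hmod j y hy 0 le_rfl, hmod i 0 le_rfl x hx]

theorem IsSeparableSubsolution.exists_initial_layer (hu : IsSeparableSubsolution T B F u)
    (hF : HamiltonianBddBelow T F) (hub : BoundedOnNetwork T u) {h : Fin K → ℝ → ℝ}
    (hh : IsNetworkDatum h) (huh : ∀ i, ∀ x ≤ (0 : ℝ), u i x 0 ≤ h i x) {ε : ℝ} (hε : 0 < ε) :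
    ∃ δ > 0, ∀ i, ∀ x ≤ (0 : ℝ), ∀ t ∈ Icc 0 T, t ≤ δ → u i x t ≤ h i x + ε := by
  obtain ⟨M₁, hM₁⟩ := hub
  obtain ⟨M₂, hM₂⟩ := hh.bounded
  have hκ : 0 < ε / 3 := by positivity
  obtain ⟨C, hC, hmod⟩ := hh.exists_le_add_mul_sq hκ
  set D := (|M₁| + |M₂|) / C + 1
  have hCD : |M₁| + |M₂| ≤ C * D ^ 2 := by
    have hD : C * D = |M₁| + |M₂| + C := by simp only [D]; field_simp
    have h1D : 1 ≤ D := le_add_of_nonneg_left (by positivity)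
    linarith [mul_le_mul_of_nonneg_left (le_self_pow₀ h1D two_ne_zero) hC.le]
  set P := |B| + 2 * C * D + 1
  choose A' hA' using fun i => hF i (2 * C * D + P)
  obtain ⟨A₁, hA₁⟩ := Finite.exists_le A'
  set A := max A₁ 0 + 1
  have hA : 0 < A := by positivity
  refine ⟨ε / 3 / A, by positivity, fun i x hx t ht htδ => ?_⟩
  have hbarrier := hu.le_add_initialBarrier (i := i) (c := h i x + ε / 3) (P := P) hx hC hκ
    (by positivity : 0 ≤ D) hA.le (fun j y hy t ht => le_of_abs_le (hM₁ j y hy t ht))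
    (fun j y hy => (huh j y hy).trans (hmod i x hx j y hy))
    (by linarith [neg_le_of_abs_le (hM₂ i x hx), le_abs_self M₁, le_abs_self M₂])
    (lt_add_one _)
    (fun j t ht y hy p hp => by linarith [hA' j t ht y hy p hp, hA₁ j, le_max_left A₁ 0])
    i x hx t ht
  have hAt : A * t ≤ ε / 3 := by rwa [le_div_iff₀' hA] at htδ
  linarith [initialBarrier_self_le hκ.le (by positivity : 0 ≤ P) hx C i]

end InitialLayer

section HamiltonianRegularity

variable {K : ℕ} {T η : ℝ} {H : Fin K → ℝ → ℝ → ℝ → ℝ} {h : ℝ → ℝ}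

theorem HamiltonianLipschitz.continuousHamiltonian (hLip : HamiltonianLipschitz T H) (i : Fin K) :
    ContinuousHamiltonian T (H i) := by
  rintro ⟨t, x, p⟩ ⟨ht, hx, -⟩
  obtain ⟨L, hL⟩ := hLip i (|p| + 1) (by positivity)
  have hnear : ∀ᶠ z : ℝ × ℝ × ℝ in 𝓝[Icc 0 T ×ˢ Iic 0 ×ˢ univ] (t, x, p), |z.2.2| < |p| + 1 :=
    mem_nhdsWithin_of_mem_nhds ((continuous_abs.comp (continuous_snd.comp continuous_snd)).tendsto
      (t, x, p) |>.eventually (gt_mem_nhds (lt_add_one |p|)))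
  have hlim : Tendsto (fun z : ℝ × ℝ × ℝ => L * (|z.1 - t| + |z.2.1 - x| + |z.2.2 - p|))
      (𝓝[Icc 0 T ×ˢ Iic 0 ×ˢ univ] (t, x, p)) (𝓝 0) :=
    (Continuous.tendsto' (by fun_prop) (t, x, p) 0 (by simp)).mono_left nhdsWithin_le_nhds
  refine tendsto_iff_dist_tendsto_zero.2
    (squeeze_zero' (Eventually.of_forall fun _ => dist_nonneg) ?_ hlim)
  filter_upwards [hnear, self_mem_nhdsWithin] with z hz hz'
  exact hL z.1 hz'.1 t ht z.2.1 hz'.2.1 x hx z.2.2 p hz.le (lt_add_one |p|).le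

theorem ContinuousHamiltonian.reflectedHamiltonian {i : Fin K}
    (hH : ContinuousHamiltonian T (H i)) : ContinuousHamiltonian T (reflectedHamiltonian H i) :=
  (ContinuousOn.comp (g := fun z : ℝ × ℝ × ℝ => H i z.1 z.2.1 z.2.2) hH
    (f := fun z : ℝ × ℝ × ℝ => (z.1, z.2.1, -z.2.2)) (by fun_prop)
    fun _ hz => ⟨hz.1, hz.2.1, mem_univ _⟩).neg

theorem ContinuousHamiltonian.shiftedHamiltonian {i : Fin K}
    (hH : ContinuousHamiltonian T (H i)) (hh : ContDiff ℝ 1 h) (η : ℝ) :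
    ContinuousHamiltonian T (shiftedHamiltonian h η H i) := by
  have := hh.continuous_deriv le_rfl
  exact (hH.comp (f := fun z : ℝ × ℝ × ℝ => (z.1, z.2.1, z.2.2 + deriv h z.2.1)) (by fun_prop)
    fun _ hz => ⟨hz.1, hz.2.1, mem_univ _⟩).add continuousOn_const

theorem HamiltonianCoercive.shiftedHamiltonian (hH : HamiltonianCoercive T H) {β : ℝ}
    (hβ : ∀ x, |deriv h x| ≤ β) (η : ℝ) : HamiltonianCoercive T (shiftedHamiltonian h η H) :=
  fun i M => by
    obtain ⟨R, hR⟩ := hH i (M - η)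
    refine ⟨R + β, fun t ht x hx p hp => ?_⟩
    have htri := abs_sub_abs_le_abs_sub p (-deriv h x)
    rw [abs_neg, sub_neg_eq_add] at htri
    exact sub_le_iff_le_add.1 (hR t ht x hx _ (by linarith [hβ x]))

theorem HamiltonianCoercive.exists_abs_le (hH : HamiltonianCoercive T H) (l : ℝ) :
    ∃ R, ∀ i, ∀ t ∈ Icc 0 T, ∀ x ≤ (0 : ℝ), ∀ p, H i t x p ≤ l → |p| ≤ R := by
  choose R hR using fun i => hH i (l + 1)
  obtain ⟨R', hR'⟩ := Finite.exists_le R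
  refine ⟨R', fun i t ht x hx p hp => ?_⟩
  by_contra! hlt
  linarith [hR i t ht x hx p ((hR' i).trans hlt.le)]

theorem HamiltonianLipschitz.exists_forall_abs_sub_le (hLip : HamiltonianLipschitz T H) (R : ℝ) :
    ∃ L ≥ 0, ∀ i, ∀ t ∈ Icc 0 T, ∀ s ∈ Icc 0 T, ∀ x ≤ (0 : ℝ), ∀ p q : ℝ, |p| ≤ R → |q| ≤ R →
      |H i t x p - H i s x q| ≤ L * (|t - s| + |p - q|) := by
  choose L hL using fun i => hLip i (max R 1) (by positivity)
  obtain ⟨L', hL'⟩ := Finite.exists_le L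
  refine ⟨max L' 0, le_max_right _ _, fun i t ht s hs x hx p q hp hq => ?_⟩
  have hle := hL i t ht s hs x hx x hx p q (hp.trans (le_max_left _ _)) (hq.trans (le_max_left _ _))
  rw [sub_self, abs_zero, add_zero] at hle
  exact hle.trans (mul_le_mul_of_nonneg_right ((hL' i).trans (le_max_left _ _)) (by positivity))

end HamiltonianRegularity

section TimeGap

variable {K : ℕ} {T η ε : ℝ} {H : Fin K → ℝ → ℝ → ℝ → ℝ} {u w : Fin K → ℝ → ℝ → ℝ}

/-- `w` is Lipschitz in time, uniformly on the network. -/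
def TimeLipschitzOnNetwork {K : ℕ} (T : ℝ) (w : Fin K → ℝ → ℝ → ℝ) : Prop :=
  ∃ L ≥ 0, ∀ i, ∀ x ≤ (0 : ℝ), ∀ t ∈ Icc 0 T, ∀ s ∈ Icc 0 T, |w i x t - w i x s| ≤ L * |t - s|

/-- `t ↦ U t` and `s ↦ W s` satisfy the inequality of `IsDoubledMax` at a fixed point of the
network. -/
def IsTimeDoubledMax (T ε : ℝ) (U W : ℝ → ℝ) (τ σ : ℝ) : Prop :=
  ∀ t ∈ Icc 0 T, ∀ s ∈ Icc 0 T,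
    U t + W s - (t - s) ^ 2 / (2 * ε) ≤ U τ + W σ - (τ - σ) ^ 2 / (2 * ε)

/-- At the two times `τ`, `σ` of a doubled maximum of `u - η t` and `w` the Hamiltonians differ so
little that the inequality for `u` persists when `τ` is replaced by `σ`, with half of the gain `η`.
The slopes concerned are bounded by `R`. -/
def TimeGapNegligible {K : ℕ} (T : ℝ) (H : Fin K → ℝ → ℝ → ℝ → ℝ) (u w : Fin K → ℝ → ℝ → ℝ)
    (η ε R : ℝ) : Prop :=
  ∀ i₀, ∀ x ≤ (0 : ℝ), ∀ τ ∈ Icc 0 T, ∀ σ ∈ Icc 0 T,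
    IsTimeDoubledMax T ε (fun t => u i₀ x t - η * t) (w i₀ x) τ σ →
      ∀ i p, (τ - σ) / ε + H i τ x p + η ≤ 0 → |p| ≤ R ∧ (τ - σ) / ε + H i σ x p ≤ -(η / 2)

theorem LipschitzOnNetwork.timeLipschitzOnNetwork (hw : LipschitzOnNetwork T w) :
    TimeLipschitzOnNetwork T w := by
  obtain ⟨L, hL⟩ := hw
  refine ⟨|L|, abs_nonneg L, fun i x hx t ht s hs => ?_⟩
  have hle := hL i x hx x hx t ht s hs
  rw [sub_self, abs_zero, zero_add] at hle
  exact hle.trans (mul_le_mul_of_nonneg_right (le_abs_self L) (abs_nonneg _))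

theorem TimeLipschitzOnNetwork.neg (hw : TimeLipschitzOnNetwork T w) :
    TimeLipschitzOnNetwork T fun i x t => -w i x t := by
  simpa only [TimeLipschitzOnNetwork, neg_sub_neg, abs_sub_comm] using hw

theorem IsTimeDoubledMax.symm {U W : ℝ → ℝ} {τ σ : ℝ} (hmax : IsTimeDoubledMax T ε U W τ σ) :
    IsTimeDoubledMax T ε W U σ τ := fun s hs t ht => by
  rw [sub_sq_comm s t, sub_sq_comm σ τ, add_comm (W s), add_comm (W σ)]
  exact hmax t ht s hs

theorem IsTimeDoubledMax.abs_div_le {U W : ℝ → ℝ} {τ σ L : ℝ}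
    (hmax : IsTimeDoubledMax T ε U W τ σ) (hε : 0 < ε) (hσ : σ ∈ Icc 0 T) (hL : 0 ≤ L)
    (hU : U τ - U σ ≤ L * |τ - σ|) : |(τ - σ) / ε| ≤ 2 * L := by
  have hle := hmax σ hσ σ hσ
  rw [sub_self, zero_pow two_ne_zero, zero_div] at hle
  have hsq : |τ - σ| ^ 2 ≤ L * |τ - σ| * (2 * ε) := by
    rw [sq_abs, ← div_le_iff₀ (by positivity)]
    linarith
  rw [abs_div, abs_of_pos hε, div_le_iff₀ hε]
  by_contra! hlt
  nlinarith [(by positivity : 0 ≤ 2 * L * ε)]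

theorem exists_forall_abs_div_le (hη : 0 ≤ η)
    (hreg : TimeLipschitzOnNetwork T u ∨ TimeLipschitzOnNetwork T w) :
    ∃ l ≥ 0, ∀ ε > 0, ∀ i, ∀ x ≤ (0 : ℝ), ∀ τ ∈ Icc 0 T, ∀ σ ∈ Icc 0 T,
      IsTimeDoubledMax T ε (fun t => u i x t - η * t) (w i x) τ σ → |(τ - σ) / ε| ≤ l := by
  obtain ⟨L, hL0, hL⟩ | ⟨L, hL0, hL⟩ := hreg
  · refine ⟨2 * (L + η), by positivity, fun ε hε i x hx τ hτ σ hσ hmax =>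
      hmax.abs_div_le hε hσ (by positivity) ?_⟩
    have hdrift := mul_le_mul_of_nonneg_left (neg_le_abs (τ - σ)) hη
    linarith [le_of_abs_le (hL i x hx τ hτ σ hσ)]
  · refine ⟨2 * L, by positivity, fun ε hε i x hx τ hτ σ hσ hmax => ?_⟩
    rw [← neg_sub, neg_div, abs_neg]
    exact hmax.symm.abs_div_le hε hτ hL0 (le_of_abs_le (hL i x hx σ hσ τ hτ))

theorem TimeIndependent.exists_timeGapNegligible (hH : TimeIndependent T H)
    (hCoer : HamiltonianCoercive T H) (hη : 0 ≤ η) (hε : 0 < ε) :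
    ∃ R, TimeGapNegligible T H u w η ε R := by
  obtain ⟨R, hR⟩ := hCoer.exists_abs_le (T / ε)
  refine ⟨R, fun i₀ x hx τ hτ σ hσ _ i p hp => ⟨hR i τ hτ x hx p ?_, ?_⟩⟩
  · have hgap : -((τ - σ) / ε) ≤ T / ε := by
      rw [← neg_div]
      exact div_le_div_of_nonneg_right (by linarith [hτ.1, hσ.2]) hε.le
    linarith
  · rw [hH i σ hσ τ hτ x hx p]
    linarith

theorem HamiltonianLipschitz.exists_timeGapNegligible (hLip : HamiltonianLipschitz T H)
    (hCoer : HamiltonianCoercive T H) (hη : 0 < η)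
    (hreg : TimeLipschitzOnNetwork T u ∨ TimeLipschitzOnNetwork T w) :
    ∃ ε₀ > 0, ∃ R, ∀ ε > 0, ε ≤ ε₀ → TimeGapNegligible T H u w η ε R := by
  obtain ⟨l, hl0, hl⟩ := exists_forall_abs_div_le hη.le hreg
  obtain ⟨R, hR⟩ := hCoer.exists_abs_le l
  obtain ⟨L, hL0, hL⟩ := hLip.exists_forall_abs_sub_le R
  obtain ⟨ε₀, hε₀, -, -, hε₀η⟩ := exists_pos_le_le_mul_le (half_pos hη) one_pos (L * l)
  refine ⟨ε₀, hε₀, R, fun ε hε hεε₀ i₀ x hx τ hτ σ hσ hmax i p hp => ?_⟩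
  have hgap := hl ε hε i₀ x hx τ hτ σ hσ hmax
  have hpR : |p| ≤ R := hR i τ hτ x hx p (by linarith [neg_le_of_abs_le hgap])
  have hHτσ := hL i σ hσ τ hτ x hx p p hpR hpR
  have hdist : L * |σ - τ| ≤ η / 2 := by
    rw [abs_div, abs_of_pos hε, div_le_iff₀ hε, abs_sub_comm] at hgap
    calc L * |σ - τ| ≤ L * (l * ε) := mul_le_mul_of_nonneg_left hgap hL0
      _ = L * l * ε := by ring
      _ ≤ L * l * ε₀ := mul_le_mul_of_nonneg_left hεε₀ (by positivity)
      _ ≤ η / 2 := hε₀η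
  rw [sub_self, abs_zero, add_zero] at hHτσ
  exact ⟨hpR, by linarith [le_of_abs_le hHτσ]⟩

theorem exists_timeGapNegligible (hLip : HamiltonianLipschitz T H)
    (hCoer : HamiltonianCoercive T H) (hη : 0 < η)
    (hreg : TimeIndependent T H ∨ TimeLipschitzOnNetwork T u ∨ TimeLipschitzOnNetwork T w) :
    ∃ ε₀ > 0, ∀ ε > 0, ε ≤ ε₀ → ∃ R, TimeGapNegligible T H u w η ε R := by
  obtain hH | hreg := hreg
  · exact ⟨1, one_pos, fun ε hε _ => hH.exists_timeGapNegligible hCoer hη.le hε⟩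
  · obtain ⟨ε₀, hε₀, R, hR⟩ := hLip.exists_timeGapNegligible hCoer hη hreg
    exact ⟨ε₀, hε₀, fun ε hε hεε₀ => ⟨R, hR ε hε hεε₀⟩⟩

end TimeGap

section Comparison

variable {K : ℕ} {T B B' η ε : ℝ} {F G H : Fin K → ℝ → ℝ → ℝ → ℝ} {u w : Fin K → ℝ → ℝ → ℝ}

theorem BoundedOnNetwork.neg (hw : BoundedOnNetwork T w) :
    BoundedOnNetwork T fun i x t => -w i x t := by
  simpa only [BoundedOnNetwork, abs_neg] using hw

theorem InitiallyUniformlyContinuous.neg (hw : InitiallyUniformlyContinuous w) :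
    InitiallyUniformlyContinuous fun i x t => -w i x t := fun i =>
  uniformContinuous_neg.comp_uniformContinuousOn (hw i)

theorem InitiallyUniformlyContinuous.isNetworkDatum (hc : InitiallyUniformlyContinuous u)
    (hT : 0 ≤ T) (hub : BoundedOnNetwork T u) (hglued : Glued T u) :
    IsNetworkDatum fun i x => u i x 0 where
  bounded := hub.imp fun _ hM i x hx => hM i x hx 0 ⟨le_rfl, hT⟩
  glued i j := hglued i j 0 ⟨le_rfl, hT⟩
  uniformContinuousOn := hc

theorem IsSeparableSubsolution.exists_initial_layer_add_of_left (hT : 0 ≤ T)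
    (hu : IsSeparableSubsolution T B F u) (hw : IsSeparableSubsolution T B' G w)
    (hF : HamiltonianBddBelow T F) (hG : HamiltonianBddBelow T G) (hub : BoundedOnNetwork T u)
    (hwb : BoundedOnNetwork T w) (hc : InitiallyUniformlyContinuous u) {m : ℝ}
    (hm : ∀ i, ∀ x ≤ (0 : ℝ), u i x 0 + w i x 0 ≤ m) (hε : 0 < ε) :
    ∃ δ > 0, ∀ i, ∀ x ≤ (0 : ℝ), ∀ t ∈ Icc 0 T, ∀ s ∈ Icc 0 T, t ≤ δ → s ≤ δ →
      u i x t + w i x s ≤ m + ε := by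
  have hdatum := hc.isNetworkDatum hT hub hu.glued
  obtain ⟨δ₁, hδ₁, hu'⟩ :=
    hu.exists_initial_layer hF hub hdatum (fun _ _ _ => le_rfl) (half_pos hε)
  obtain ⟨δ₂, hδ₂, hw'⟩ := hw.exists_initial_layer hG hwb (hdatum.const_sub m)
    (fun i x hx => by linarith [hm i x hx]) (half_pos hε)
  refine ⟨min δ₁ δ₂, lt_min hδ₁ hδ₂, fun i x hx t ht s hs htδ hsδ => ?_⟩
  linarith [hu' i x hx t ht (htδ.trans (min_le_left _ _)),
    hw' i x hx s hs (hsδ.trans (min_le_right _ _))]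

theorem IsSeparableSubsolution.exists_initial_layer_add (hT : 0 ≤ T)
    (hu : IsSeparableSubsolution T B F u) (hw : IsSeparableSubsolution T B' G w)
    (hF : HamiltonianBddBelow T F) (hG : HamiltonianBddBelow T G) (hub : BoundedOnNetwork T u)
    (hwb : BoundedOnNetwork T w)
    (hc : InitiallyUniformlyContinuous u ∨ InitiallyUniformlyContinuous w) {m : ℝ}
    (hm : ∀ i, ∀ x ≤ (0 : ℝ), u i x 0 + w i x 0 ≤ m) (hε : 0 < ε) :
    ∃ δ > 0, ∀ i, ∀ x ≤ (0 : ℝ), ∀ t ∈ Icc 0 T, ∀ s ∈ Icc 0 T, t ≤ δ → s ≤ δ →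
      u i x t + w i x s ≤ m + ε := by
  obtain hc | hc := hc
  · exact hu.exists_initial_layer_add_of_left hT hw hF hG hub hwb hc hm hε
  · obtain ⟨δ, hδ, hle⟩ := hw.exists_initial_layer_add_of_left hT hu hG hF hwb hub hc
      (fun i x hx => (add_comm _ _).trans_le (hm i x hx)) hε
    exact ⟨δ, hδ, fun i x hx t ht s hs htδ hsδ =>
      (add_comm _ _).trans_le (hle i x hx s hs t ht hsδ htδ)⟩

theorem exists_isDoubledMax (hu : ∀ i, UpperSemicontinuousOn (fun z : ℝ × ℝ => u i z.1 z.2)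
      (edgeCyl T)) (hw : ∀ i, UpperSemicontinuousOn (fun z : ℝ × ℝ => w i z.1 z.2) (edgeCyl T))
    (hε : 0 ≤ ε) {i₁ : Fin K} {x₁ t₁ r : ℝ} (hx₁ : x₁ ≤ 0) (ht₁ : t₁ ∈ Icc 0 T)
    (hfar : ∀ i, ∀ x ≤ (0 : ℝ), x < r → ∀ t ∈ Icc 0 T, ∀ s ∈ Icc 0 T,
      u i x t + w i x s < u i₁ x₁ t₁ + w i₁ x₁ t₁) :
    ∃ i₀, ∃ x₀ ≤ 0, ∃ τ ∈ Icc 0 T, ∃ σ ∈ Icc 0 T, IsDoubledMax T ε u w i₀ x₀ τ σ := by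
  set S : Set (ℝ × ℝ × ℝ) := Iic 0 ×ˢ Icc 0 T ×ˢ Icc 0 T
  have husc : ∀ i, UpperSemicontinuousOn (fun z : ℝ × ℝ × ℝ =>
      u i z.1 z.2.1 + w i z.1 z.2.2 - (z.2.1 - z.2.2) ^ 2 / (2 * ε)) S := fun i => by
    have hu' := (hu i).comp (g := fun z : ℝ × ℝ × ℝ => (z.1, z.2.1)) (t := S) (by fun_prop)
      fun z hz => ⟨hz.1, hz.2.1⟩
    have hw' := (hw i).comp (g := fun z : ℝ × ℝ × ℝ => (z.1, z.2.2)) (t := S) (by fun_prop)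
      fun z hz => ⟨hz.1, hz.2.2⟩
    exact upperSemicontinuousOn_sub_continuousOn (hu'.add hw') (by fun_prop)
  obtain ⟨i₀, ⟨x₀, τ, σ⟩, ⟨hx₀, hτ, hσ⟩, hmax⟩ := exists_forall_le_of_lt_outside_compact
    (C := Icc r 0 ×ˢ Icc 0 T ×ˢ Icc 0 T) (isCompact_Icc.prod (isCompact_Icc.prod isCompact_Icc))
    (prod_mono Icc_subset_Iic_self subset_rfl) husc (i₀ := i₁) (x₀ := (x₁, t₁, t₁))
    ⟨hx₁, ht₁, ht₁⟩ fun i z hz hzC => by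
      have hzr : z.1 < r := by
        by_contra! hge
        exact hzC ⟨⟨hge, hz.1⟩, hz.2⟩
      have hlt := hfar i z.1 hz.1 hzr z.2.1 hz.2.1 z.2.2 hz.2.2
      rw [sub_self, zero_pow two_ne_zero, zero_div, sub_zero]
      exact (sub_le_self _ (by positivity)).trans_lt hlt
  exact ⟨i₀, x₀, hx₀.2, τ, hτ, σ, hσ,
    fun i x hx t ht s hs => hmax i (x, t, s) ⟨hx, ht, hs⟩⟩

theorem pos_and_pos_of_initial_layer {A N c δ τ σ : ℝ} (hε : 0 < ε) (hδ : 0 < δ)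
    (hlayer : τ ≤ δ → σ ≤ δ → A ≤ c) (hlow : c < A - (τ - σ) ^ 2 / (2 * ε))
    (hup : A ≤ c + N) (hN : 2 * N * ε ≤ δ ^ 2) : 0 < τ ∧ 0 < σ := by
  have hclose : |τ - σ| ≤ δ := by
    have hsq : (τ - σ) ^ 2 / (2 * ε) ≤ N := by linarith
    rw [div_le_iff₀ (by positivity)] at hsq
    exact abs_le_of_sq_le_sq (by linarith) hδ.le
  have hout : τ ≤ δ → ¬σ ≤ δ := fun hτδ hσδ => by
    have : 0 ≤ (τ - σ) ^ 2 / (2 * ε) := by positivity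
    linarith [hlayer hτδ hσδ]
  constructor <;> by_contra! hle
  · exact hout (by linarith) (by linarith [neg_le_of_abs_le hclose])
  · exact hout (by linarith [le_of_abs_le hclose]) (by linarith)

theorem not_isDoubledMax (hLip : HamiltonianLipschitz T H) (hCoer : HamiltonianCoercive T H)
    (hu : IsSeparableSubsolution T B H u)
    (hw : IsSeparableSubsolution T (-B) (reflectedHamiltonian H) w) {h : ℝ → ℝ}
    (hh : ContDiff ℝ 1 h) (hh0 : deriv h 0 = 0) {β R L : ℝ} (hhβ : ∀ x, |deriv h x| ≤ β)
    (hβ : β ≤ 1) (hL0 : 0 ≤ L) (hL : ∀ i, ∀ t ∈ Icc 0 T, ∀ s ∈ Icc 0 T, ∀ x ≤ (0 : ℝ), ∀ p q : ℝ,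
      |p| ≤ R + 1 → |q| ≤ R + 1 → |H i t x p - H i s x q| ≤ L * (|t - s| + |p - q|))
    (hLβ : L * β < η / 2) (hε : 0 < ε) (hgap : TimeGapNegligible T H u w η ε R) {i₀ : Fin K}
    {x₀ τ σ : ℝ} (hx₀ : x₀ ≤ 0) (hτ : τ ∈ Ioc 0 T) (hσ : σ ∈ Ioc 0 T) :
    ¬IsDoubledMax T ε (fun i x t => u i x t - (h x + η * t)) w i₀ x₀ τ σ := fun hmax => by
  have hτ' := Ioc_subset_Icc_self hτ
  have hσ' := Ioc_subset_Icc_self hσ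
  have hcont := hLip.continuousHamiltonian
  obtain ⟨i, p, hp, hp'⟩ := hmax.exists_slope hε (hu.sub_separable hh hh0 η) hw
    (fun i => (hcont i).shiftedHamiltonian hh η) (fun i => (hcont i).reflectedHamiltonian)
    (hCoer.shiftedHamiltonian hhβ η) hx₀ hτ hσ
  simp only [shiftedHamiltonian, ← add_assoc] at hp
  simp only [reflectedHamiltonian, neg_neg] at hp'
  have hmax' : IsTimeDoubledMax T ε (fun t => u i₀ x₀ t - η * t) (w i₀ x₀) τ σ :=
    fun t ht s hs => by linarith [hmax i₀ x₀ hx₀ t ht s hs]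
  obtain ⟨hR, hle⟩ := hgap i₀ x₀ hx₀ τ hτ' σ hσ' hmax' i _ hp
  have hpR : |p| ≤ R + 1 := by
    have htri := abs_sub_abs_le_abs_sub p (p + deriv h x₀)
    rw [sub_add_cancel_left, abs_neg] at htri
    linarith [hhβ x₀]
  have hdiff := hL i σ hσ' σ hσ' x₀ hx₀ p (p + deriv h x₀) hpR (by linarith)
  rw [sub_self, abs_zero, zero_add, sub_add_cancel_left, abs_neg] at hdiff
  linarith [le_of_abs_le hdiff, mul_le_mul_of_nonneg_left (hhβ x₀) hL0]

theorem IsSeparableSubsolution.add_le_add_mul_of_timeGapNegligible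
    (hLip : HamiltonianLipschitz T H) (hCoer : HamiltonianCoercive T H)
    (hu : IsSeparableSubsolution T B H u)
    (hw : IsSeparableSubsolution T (-B) (reflectedHamiltonian H) w) {c N δ R : ℝ} (hδ : 0 < δ)
    (hlayer : ∀ i, ∀ x ≤ (0 : ℝ), ∀ t ∈ Icc 0 T, ∀ s ∈ Icc 0 T, t ≤ δ → s ≤ δ →
      u i x t + w i x s ≤ c)
    (hN : ∀ i, ∀ x ≤ (0 : ℝ), ∀ t ∈ Icc 0 T, ∀ s ∈ Icc 0 T, u i x t + w i x s ≤ c + N)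
    (hη : 0 < η) (hε : 0 < ε) (hεδ : 2 * N * ε ≤ δ ^ 2) (hgap : TimeGapNegligible T H u w η ε R) :
    ∀ i, ∀ x ≤ (0 : ℝ), ∀ t ∈ Icc 0 T, u i x t + w i x t ≤ c + η * t := by
  intro i₁ x₁ hx₁ t₁ ht₁
  by_contra! hlt
  obtain ⟨L, hL0, hL⟩ := hLip.exists_forall_abs_sub_le (R + 1)
  have hg0 := softAbs_nonneg 1
  obtain ⟨β, hβ, -, hβ1, hβmul⟩ := exists_pos_le_le_mul_le
    (lt_min (by positivity : 0 < η / 4) (half_pos (sub_pos.2 hlt))) one_pos (L + softAbs 1 x₁)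
  obtain ⟨hβη, hβc⟩ := le_min_iff.1 hβmul
  have hLβ : 0 ≤ L * β := by positivity
  have hgβ : 0 ≤ softAbs 1 x₁ * β := mul_nonneg (hg0 x₁) hβ.le
  set h : ℝ → ℝ := fun x => β * softAbs 1 x
  have hh : ContDiff ℝ 1 h := contDiff_const.mul (contDiff_softAbs one_ne_zero)
  have hh0 : deriv h 0 = 0 := by
    rw [deriv_const_mul_softAbs one_ne_zero, deriv_softAbs_zero one_ne_zero, mul_zero]
  have hstart : c < u i₁ x₁ t₁ - (h x₁ + η * t₁) + w i₁ x₁ t₁ := by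
    simp only [h]
    linarith
  obtain ⟨i₀, x₀, hx₀, τ, hτ, σ, hσ, hmax⟩ := exists_isDoubledMax
    (u := fun i x t => u i x t - (h x + η * t)) (r := -(1 + N / β))
    (hu.sub_separable hh hh0 η).usc hw.usc hε.le hx₁ ht₁
    fun i x hx hxr t ht s hs => by
      have hgrowth : N ≤ h x := by
        have hlin := abs_sub_le_softAbs 1 x
        rw [abs_of_nonpos hx] at hlin
        exact (div_le_iff₀' hβ).1 (by linarith)
      linarith [hN i x hx t ht s hs, mul_nonneg hη.le ht.1]
  have hval := hmax i₁ x₁ hx₁ t₁ ht₁ t₁ ht₁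
  rw [sub_self, zero_pow two_ne_zero, zero_div] at hval
  have hlow : c < u i₀ x₀ τ + w i₀ x₀ σ - (τ - σ) ^ 2 / (2 * ε) := by
    linarith [hstart, mul_nonneg hβ.le (hg0 x₀), mul_nonneg hη.le hτ.1]
  obtain ⟨hτ0, hσ0⟩ := pos_and_pos_of_initial_layer hε hδ (hlayer i₀ x₀ hx₀ τ hτ σ hσ) hlow
    (hN i₀ x₀ hx₀ τ hτ σ hσ) hεδ
  exact not_isDoubledMax hLip hCoer hu hw hh hh0
    (abs_deriv_const_mul_softAbs_le one_ne_zero hβ.le) hβ1 hL0 hL (by linarith) hε hgap hx₀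
    ⟨hτ0, hτ.2⟩ ⟨hσ0, hσ.2⟩ hmax

theorem IsSeparableSubsolution.add_le_of_initial_add_le (hT : 0 < T)
    (hLip : HamiltonianLipschitz T H) (hCoer : HamiltonianCoercive T H)
    (hu : IsSeparableSubsolution T B H u)
    (hw : IsSeparableSubsolution T (-B) (reflectedHamiltonian H) w)
    (hub : BoundedOnNetwork T u) (hwb : BoundedOnNetwork T w)
    (hc : InitiallyUniformlyContinuous u ∨ InitiallyUniformlyContinuous w)
    (hreg : TimeIndependent T H ∨ TimeLipschitzOnNetwork T u ∨ TimeLipschitzOnNetwork T w) {m : ℝ}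
    (hm : ∀ i, ∀ x ≤ (0 : ℝ), u i x 0 + w i x 0 ≤ m) :
    ∀ i, ∀ x ≤ (0 : ℝ), ∀ t ∈ Icc 0 T, u i x t + w i x t ≤ m := by
  refine fun i x hx t ht => le_of_forall_pos_le_add fun κ hκ => ?_
  obtain ⟨δ, hδ, hlayer⟩ := hu.exists_initial_layer_add hT.le hw
    (hLip.hamiltonianBddBelow hCoer) (hu.hamiltonianBddBelow_reflectedHamiltonian hT hLip hCoer hub)
    hub hwb hc hm (half_pos hκ)
  have hη : 0 < κ / 2 / T := by positivity
  obtain ⟨ε₀, hε₀, hgap⟩ := exists_timeGapNegligible hLip hCoer hη hreg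
  obtain ⟨M₁, hM₁⟩ := hub
  obtain ⟨M₂, hM₂⟩ := hwb
  set N := M₁ + M₂ - (m + κ / 2)
  have hN : ∀ j, ∀ y ≤ (0 : ℝ), ∀ t ∈ Icc 0 T, ∀ s ∈ Icc 0 T,
      u j y t + w j y s ≤ m + κ / 2 + N := fun j y hy t ht s hs => by
    simp only [N]
    linarith [le_of_abs_le (hM₁ j y hy t ht), le_of_abs_le (hM₂ j y hy s hs)]
  obtain ⟨ε, hε, -, hεε₀, hεδ⟩ := exists_pos_le_le_mul_le (pow_pos hδ 2) hε₀ (2 * N)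
  obtain ⟨R, hR⟩ := hgap ε hε hεε₀
  have hle := hu.add_le_add_mul_of_timeGapNegligible hLip hCoer hw hδ hlayer hN hη hε hεδ hR
    i x hx t ht
  have hdrift : κ / 2 / T * t ≤ κ / 2 :=
    (mul_le_mul_of_nonneg_left ht.2 hη.le).trans_eq (div_mul_cancel₀ _ hT.ne')
  linarith

end Comparison

section SupDiff

variable {K : ℕ} {T : ℝ} {u v : Fin K → ℝ → ℝ → ℝ}

theorem le_supDiff (hub : BoundedOnNetwork T u) (hvb : BoundedOnNetwork T v) {t : ℝ}
    (ht : t ∈ Icc 0 T) (i : Fin K) {x : ℝ} (hx : x ≤ 0) : u i x t - v i x t ≤ supDiff u v t := by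
  obtain ⟨M₁, hM₁⟩ := hub
  obtain ⟨M₂, hM₂⟩ := hvb
  refine le_ciSup (f := fun z : Fin K × Iic (0 : ℝ) => u z.1 z.2 t - v z.1 z.2 t)
    ⟨M₁ + M₂, ?_⟩ (i, ⟨x, hx⟩)
  rintro _ ⟨⟨j, y, hy⟩, rfl⟩
  linarith [le_of_abs_le (hM₁ j y hy t ht), neg_le_of_abs_le (hM₂ j y hy t ht)]

theorem supDiff_le (hK : 0 < K) {t m : ℝ} (hm : ∀ i, ∀ x ≤ (0 : ℝ), u i x t - v i x t ≤ m) :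
    supDiff u v t ≤ m := by
  have : Nonempty (Fin K × Iic (0 : ℝ)) := ⟨⟨0, hK⟩, 0, self_mem_Iic⟩
  exact ciSup_le fun z => hm z.1 z.2 z.2.2

end SupDiff

theorem mainTheorem6_general (K : ℕ) (hK : 0 < K) (T : ℝ) (hT : 0 < T) (B : ℝ)
    (H : Fin K → ℝ → ℝ → ℝ → ℝ)
    (hLip : HamiltonianLipschitz T H) (hCoer : HamiltonianCoercive T H)
    (u v : Fin K → ℝ → ℝ → ℝ)
    (hu : IsSubsolution T B H u) (hv : IsSupersolution T B H v)
    (hub : BoundedOnNetwork T u) (hvb : BoundedOnNetwork T v)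
    (hinit : InitiallyUniformlyContinuous u ∨ InitiallyUniformlyContinuous v)
    (hreg : TimeIndependent T H ∨ TimeLipschitzOnNetwork T u ∨ TimeLipschitzOnNetwork T v) :
    ∀ t ∈ Set.Icc 0 T, supDiff u v t ≤ supDiff u v 0 := fun t ht =>
  supDiff_le hK fun i x hx => hu.isSeparableSubsolution.add_le_of_initial_add_le hT hLip hCoer
    hv.isSeparableSubsolution_neg hub hvb.neg (hinit.imp_right .neg)
    (hreg.imp_right (.imp_right .neg)) (fun j _ hy => le_supDiff hub hvb ⟨le_rfl, hT.le⟩ j hy)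
    i x hx t ht

theorem mainTheorem6 (K : ℕ) (hK : 0 < K) (T : ℝ) (hT : 0 < T) (B : ℝ)
    (H : Fin K → ℝ → ℝ → ℝ → ℝ)
    (hLip : HamiltonianLipschitz T H) (hCoer : HamiltonianCoercive T H)
    (u v : Fin K → ℝ → ℝ → ℝ)
    (hu : IsSubsolution T B H u) (hv : IsSupersolution T B H v)
    (hub : BoundedOnNetwork T u) (hvb : BoundedOnNetwork T v)
    (hinit : InitiallyUniformlyContinuous u ∨ InitiallyUniformlyContinuous v)
    (hreg : TimeIndependent T H ∨ LipschitzOnNetwork T u ∨ LipschitzOnNetwork T v) :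
    ∀ t ∈ Set.Icc 0 T, supDiff u v t ≤ supDiff u v 0 :=
  mainTheorem6_general K hK T hT B H hLip hCoer u v hu hv hub hvb hinit
    (hreg.imp_right (.imp (·.timeLipschitzOnNetwork) (·.timeLipschitzOnNetwork)))
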